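/- Let $0<\eta<T$. Assume $f:[0,\infty)\to[0,\infty)$ is continuous, and $a:[0,T]\to[0,\infty)$ is continuous with $a(t_0)>0$ for some $t_0\in[\eta,T]$. Let $0<\alpha<\frac{2T}{\eta^2}$ and $0\le\beta<\frac{2T-\alpha\eta^2}{\alpha\eta^2-2\eta+2T}$. Put $f_0=\lim_{u\to0^+}\frac{f(u)}{u}$ and $f_\infty=\lim_{u\to\infty}\frac{f(u)}{u}$. Suppose that either (i) $f_0=0$ and $f_\infty=\infty$ (superlinear case), or (ii) $f_0=\infty$ and $f_\infty=0$ (sublinear case). Then the boundary value problem $$u''(t)+a(t)f(u(t))=0,\quad t\in(0,T),\qquad u(0)=\beta u(\eta),\quad u(T)=\alpha\int_0^\eta u(s)\,ds,$$ has at least one positive solution, that is, a function $u\in C^2([0,T])$ with $u(t)>0$ for all $t\in(0,T)$ that satisfies the equation and both boundary conditions. -/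

import Mathlib

open Set Filter Topology

namespace ThreePointBVP

/-- `f₀ = 0` and `f_∞ = ∞`, where `f₀` and `f_∞` are the limits of `f x / x` as `x → 0⁺` and
`x → ∞`. -/
def Superlinear (f : ℝ → ℝ) : Prop :=
  Tendsto (fun x => f x / x) (𝓝[>] 0) (𝓝 0) ∧ Tendsto (fun x => f x / x) atTop atTop

/-- `f₀ = ∞` and `f_∞ = 0`. -/
def Sublinear (f : ℝ → ℝ) : Prop :=
  Tendsto (fun x => f x / x) (𝓝[>] 0) atTop ∧ Tendsto (fun x => f x / x) atTop (𝓝 0)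

/-- `u` is a (classical) positive solution of `u'' + a(t) f(u) = 0` on `(0,T)` with
`u(0) = β u(η)`, `u(T) = α ∫₀^η u`. Only the values of `u` on `[0,T]` matter. -/
structure IsPositiveSolution (T η α β : ℝ) (a f u : ℝ → ℝ) : Prop where
  contDiffOn : ContDiffOn ℝ 2 u (Icc 0 T)
  ode : ∀ t ∈ Ioo 0 T, deriv (deriv u) t + a t * f (u t) = 0
  left_bc : u 0 = β * u η
  right_bc : u T = α * ∫ s in (0 : ℝ)..η, u s
  pos : ∀ t ∈ Ioo 0 T, 0 < u t

end ThreePointBVP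

/-! For a given source `y`, the solution of `u'' = -y` under the two nonlocal conditions is the
Dirichlet solution plus an affine function. The end values of that function solve a 2x2 linear
system, and the bounds on `α` and `β` make its solution nonnegative for nonnegative data. So the
solution operator `L` is positive and compact, and it inherits from the Green function the
inequality `k t * L y τ ≤ L y t` with `k t = t * (T - t) / T ^ 2` (`exists_solution_operator`).

The problem becomes `u = A u` with `A u = L (a * f u)`. The map `A` preserves the cone of `u ≥ 0`
with `k * ‖u‖ ≤ u`, whose nonzero members are positive on `(0, T)`. There `u` is comparable with its
norm, so superlinear growth of `f` makes `A` shrink small norms and enlarge large ones; sublinear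
growth does the reverse (`exists_nonzero_solution_hammerstein`). Krasnosel'skii's theorem then gives
a nonzero fixed point. The compressive case follows from Schauder's theorem, and the expansive case
from the compressive one by a radial inversion. Schauder's theorem is reduced to Brouwer's, which
rests on the nonexistence of a retraction onto the sphere: a volume that is polynomial in a
parameter would be both constant and zero. -/

namespace ThreePointBVP

open MeasureTheory Metric Module
open scoped NNReal ContDiff Manifold

/-! ### Brouwer's fixed point theorem by a volume argument. -/

section Brouwer

variable {E : Type*} [NormedAddCommGroup E]

/-- The determinant along the line `1 + t M` is a polynomial in `t` of degree at most the
dimension, so its value at `t = 1` is recovered from its values at enough nodes. -/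
theorem det_one_add_eq_sum_lagrange [NormedSpace ℝ E] [FiniteDimensional ℝ E] (s : Finset ℝ)
    (hs : finrank ℝ E < s.card) (M : E →L[ℝ] E) :
    (1 + M).det = ∑ t ∈ s, (1 + t • M).det * (Lagrange.basis s id t).eval 1 := by
  classical
  let b := finBasis ℝ E
  let A := LinearMap.toMatrix b b (M : E →ₗ[ℝ] E)
  let p : Polynomial ℝ := Matrix.det
    ((Polynomial.X : Polynomial ℝ) • A.map Polynomial.C +
      (1 : Matrix (Fin (finrank ℝ E)) (Fin (finrank ℝ E)) ℝ).map Polynomial.C)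
  have hp : ∀ t : ℝ, p.eval t = (1 + t • M).det := by
    intro t
    rw [ContinuousLinearMap.det, ← LinearMap.det_toMatrix b]
    simp only [p, A]
    rw [← Polynomial.coe_evalRingHom, RingHom.map_det]
    congr 1
    ext i j
    rcases eq_or_ne i j with rfl | h
    · simp [LinearMap.toMatrix_apply]
      ring
    · simp [LinearMap.toMatrix_apply, h, mul_comm t]
  have hdeg : p.degree < s.card := by
    refine lt_of_le_of_lt Polynomial.degree_le_natDegree ?_
    have := Polynomial.natDegree_det_X_add_C_le A 1
    rw [Fintype.card_fin] at this
    exact_mod_cast lt_of_le_of_lt this hs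
  have h := Lagrange.eq_interpolate_of_eval_eq (s := s) (v := id) (r := fun t => (1 + t • M).det)
    (injOn_id _) hdeg (fun t _ => hp t)
  have h1 := hp 1
  rw [one_smul] at h1
  rw [← h1, h, Lagrange.interpolate_apply, Polynomial.eval_finsetSum]
  simp

/-- A contractive perturbation of the identity by a map that vanishes off a set `B` maps `B`
bijectively onto itself. -/
theorem bijOn_add_of_contracting [CompleteSpace E] {B : Set E} {g : E → E} {K : ℝ≥0} (hK : K < 1)
    (hg : LipschitzWith K g) (hB : ∀ x, x ∉ B → g x = 0) : BijOn (fun x => x + g x) B B := by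
  have hinj : Function.Injective (fun x => x + g x) := by
    intro x y hxy
    have h1 : x - y = g y - g x := by
      rw [sub_eq_sub_iff_add_eq_add, add_comm (g y)]
      exact hxy
    have h2 := hg.dist_le_mul y x
    rw [dist_eq_norm, dist_comm, dist_eq_norm, ← h1] at h2
    have h3 : (K : ℝ) < 1 := by exact_mod_cast hK
    have h4 : ‖x - y‖ = 0 := by nlinarith [norm_nonneg (x - y)]
    exact sub_eq_zero.1 (norm_eq_zero.1 h4)
  have hsurj : ∀ y, ∃ x, x + g x = y := by
    intro y
    have hc : ContractingWith K (fun x => y - g x) :=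
      ⟨hK, LipschitzWith.of_dist_le_mul fun a b => by
        rw [dist_sub_left]; exact hg.dist_le_mul a b⟩
    refine ⟨hc.fixedPoint, ?_⟩
    have h : y - g hc.fixedPoint = hc.fixedPoint := hc.fixedPoint_isFixedPt
    exact (sub_eq_iff_eq_add.1 h).symm
  refine ⟨fun x hx => ?_, hinj.injOn, fun y hy => ?_⟩
  · by_contra hxB
    -- An image point outside `B` is fixed by the map, so injectivity identifies it with `x`, which
    -- lies in `B`.
    have h : (fun x => x + g x) (x + g x) = (fun x => x + g x) x := by simp [hB _ hxB]
    exact hxB (by simpa [hinj h] using hx)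
  · obtain ⟨x, rfl⟩ := hsurj y
    refine ⟨x, ?_, rfl⟩
    by_contra hx
    rw [hB x hx, add_zero] at hy
    exact hx hy

/-- Extending by zero a map that is Lipschitz on a closed ball and vanishes on its boundary. -/
theorem lipschitzWith_indicator_closedBall [NormedSpace ℝ E] {g : E → E} {K : ℝ≥0} {R : ℝ}
    (hg : LipschitzOnWith K g (closedBall 0 R)) (h0 : ∀ x, ‖x‖ = R → g x = 0) :
    LipschitzWith K ((closedBall (0 : E) R).indicator g) := by
  have key : ∀ x ∈ closedBall (0 : E) R, ∀ y ∉ closedBall (0 : E) R,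
      dist (g x) 0 ≤ K * dist x y := by
    intro x hx y hy
    rw [mem_closedBall_zero_iff] at hx hy
    -- The segment from `x` to `y` crosses the sphere, where `g` vanishes, at a point no farther
    -- from `x` than `y` is.
    have hc : ContinuousOn (fun t : ℝ => ‖x + t • (y - x)‖) (Icc 0 1) := by fun_prop
    have hm : R ∈ Icc ‖x + (0 : ℝ) • (y - x)‖ ‖x + (1 : ℝ) • (y - x)‖ := by
      simp only [zero_smul, add_zero, one_smul, add_sub_cancel]
      exact ⟨hx, (not_le.1 hy).le⟩
    obtain ⟨t, ht, htR⟩ := intermediate_value_Icc zero_le_one hc hm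
    have h1 := hg.dist_le_mul x (mem_closedBall_zero_iff.2 hx) (x + t • (y - x))
      (mem_closedBall_zero_iff.2 htR.le)
    rw [h0 _ htR] at h1
    refine h1.trans (mul_le_mul_of_nonneg_left ?_ K.2)
    rw [dist_self_add_right, norm_smul, Real.norm_of_nonneg ht.1, dist_comm, dist_eq_norm]
    exact mul_le_of_le_one_left (norm_nonneg _) ht.2
  refine LipschitzWith.of_dist_le_mul fun x y => ?_
  by_cases hx : x ∈ closedBall (0 : E) R <;> by_cases hy : y ∈ closedBall (0 : E) R
  · simpa [indicator_of_mem hx, indicator_of_mem hy] using hg.dist_le_mul x hx y hy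
  · simpa only [indicator_of_mem hx, indicator_of_notMem hy] using key x hx y hy
  · simpa only [indicator_of_notMem hx, indicator_of_mem hy, dist_comm] using key y hy x hx
  · simp only [indicator_of_notMem hx, indicator_of_notMem hy, dist_self]
    positivity

/-- Differentiating `⟪r, r⟫ = R ^ 2` shows that the range of the derivative is orthogonal to `r x`.
An invertible derivative would have `r x ≠ 0` in its range. -/
theorem det_fderiv_eq_zero_of_norm_eq [InnerProductSpace ℝ E] [FiniteDimensional ℝ E]
    {r : E → E} {R : ℝ} (hR : 0 < R) (hr : Differentiable ℝ r) (hrR : ∀ x, ‖r x‖ = R) (x : E) :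
    (fderiv ℝ r x).det = 0 := by
  by_contra hdet
  have hd := (hr x).hasFDerivAt
  have h1 := hd.inner ℝ hd
  have h2 : (fun y => inner ℝ (r y) (r y)) = fun _ => R ^ 2 := by
    funext y; rw [real_inner_self_eq_norm_sq, hrR]
  rw [h2] at h1
  have h3 := h1.unique (hasFDerivAt_const _ _)
  have hsurj : Function.Surjective (fderiv ℝ r x : E →ₗ[ℝ] E) := by
    rw [← LinearMap.injective_iff_surjective]
    refine LinearMap.ker_eq_bot.1 ?_
    by_contra hk
    exact hdet (LinearMap.det_eq_zero_iff_ker_ne_bot.2 hk)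
  obtain ⟨v, hv⟩ := hsurj (r x)
  have h4 := congrArg (fun L : E →L[ℝ] ℝ => L v) h3
  have hv' : fderiv ℝ r x v = r x := hv
  simp [hv', hrR] at h4
  exact hR.ne' h4

/-- There is no `C¹` retraction of a closed ball onto its boundary sphere. -/
theorem no_retraction_onto_sphere [InnerProductSpace ℝ E] [FiniteDimensional ℝ E]
    {r : E → E} {R : ℝ} (hR : 0 < R) (hr : ContDiff ℝ 1 r) (hrR : ∀ x, ‖r x‖ = R)
    (hid : ∀ x, ‖x‖ = R → r x = x) : False := by
  borelize E
  let μ : Measure E := Measure.addHaar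
  let B : Set E := closedBall 0 R
  let g : E → E := fun x => r x - x
  let D : E → E →L[ℝ] E := fun x => fderiv ℝ r x - 1
  have hBc : IsCompact B := isCompact_closedBall 0 R
  have hg : ContDiff ℝ 1 g := hr.sub contDiff_id
  have hgD : ∀ x, HasFDerivAt g (D x) x := fun x =>
    ((hr.differentiable one_ne_zero) x).hasFDerivAt.sub (hasFDerivAt_id x)
  have hDc : Continuous D := (hr.continuous_fderiv one_ne_zero).sub continuous_const
  obtain ⟨K, hK⟩ := hg.contDiffOn.exists_lipschitzOnWith one_ne_zero (convex_closedBall 0 R) hBc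
  obtain ⟨C, hC⟩ := hBc.exists_bound_of_continuousOn hDc.continuousOn
  have hpos : ∀ᶠ L : E →L[ℝ] E in 𝓝 0, 0 < (1 + L).det := by
    have hc : Continuous fun L : E →L[ℝ] E => (1 + L).det :=
      ContinuousLinearMap.continuous_det.comp (continuous_const.add continuous_id)
    exact hc.continuousAt.eventually_const_lt (u := (0 : ℝ)) (by simp [ContinuousLinearMap.det])
  obtain ⟨ε, hε, hεpos⟩ := Metric.eventually_nhds_iff.1 hpos
  -- For `t ≤ δ`, the first bound makes `t • g` a contraction on `B`, and the second keeps the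
  -- Jacobian of `x + t • g x` positive.
  obtain ⟨δ, hδ, hδK, hδC⟩ : ∃ δ : ℝ, 0 < δ ∧ δ * K < 1 ∧ δ * C < ε := by
    have h1 : ∀ᶠ t : ℝ in 𝓝[>] 0, t * K < 1 :=
      nhdsWithin_le_nhds <| (continuous_mul_const (K : ℝ)).continuousAt.eventually_lt_const
        (by simp)
    have h2 : ∀ᶠ t : ℝ in 𝓝[>] 0, t * C < ε :=
      nhdsWithin_le_nhds <| (continuous_mul_const C).continuousAt.eventually_lt_const
        (by simpa using hε)
    obtain ⟨t, ht1, ht2, ht3⟩ := (h1.and (h2.and self_mem_nhdsWithin)).exists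
    exact ⟨t, ht3, ht1, ht2⟩
  have hvol : ∀ t ∈ Ioc 0 δ, ∫ x in B, (1 + t • D x).det ∂μ = μ.real B := by
    intro t ht
    have hdet : ∀ x ∈ B, 0 < (1 + t • D x).det := by
      intro x hx
      refine hεpos ?_
      rw [dist_zero_right, norm_smul, Real.norm_of_nonneg ht.1.le]
      have h0 := (norm_nonneg _).trans (hC x hx)
      calc t * ‖D x‖ ≤ δ * C := mul_le_mul ht.2 (hC x hx) (norm_nonneg _) hδ.le
        _ < ε := hδC
    have hlip : LipschitzWith (t.toNNReal * K) (B.indicator fun x => t • g x) := by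
      refine lipschitzWith_indicator_closedBall ?_ fun x hx => by simp [g, hid x hx]
      refine LipschitzOnWith.of_dist_le_mul fun x hx y hy => ?_
      rw [dist_smul₀, Real.norm_of_nonneg ht.1.le, NNReal.coe_mul, Real.coe_toNNReal _ ht.1.le,
        mul_assoc]
      exact mul_le_mul_of_nonneg_left (hK.dist_le_mul x hx y hy) ht.1.le
    have hlt : (t.toNNReal * K : ℝ≥0) < 1 := by
      rw [← NNReal.coe_lt_coe, NNReal.coe_mul, Real.coe_toNNReal _ ht.1.le]
      exact (mul_le_mul_of_nonneg_right ht.2 K.2).trans_lt hδK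
    have hbij : BijOn (fun x => x + t • g x) B B :=
      (bijOn_add_of_contracting hlt hlip fun x hx => indicator_of_notMem hx _).congr
        fun x hx => by simp [indicator_of_mem hx]
    have hder : ∀ x ∈ B, HasFDerivWithinAt (fun x => x + t • g x) (1 + t • D x) B x := fun x _ =>
      ((hasFDerivAt_id x).add ((hgD x).const_smul t)).hasFDerivWithinAt
    have hcov := integral_image_eq_integral_abs_det_fderiv_smul μ hBc.measurableSet hder
      hbij.injOn (fun _ => (1 : ℝ))
    rw [hbij.image_eq] at hcov
    simp only [smul_eq_mul, mul_one, integral_const, measureReal_restrict_apply_univ] at hcov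
    rw [hcov]
    exact setIntegral_congr_fun hBc.measurableSet fun x hx => (abs_of_pos (hdet x hx)).symm
  -- The integrated Jacobian is a polynomial in `t` of degree at most the dimension, so this many
  -- nodes extrapolate its constant value to `t = 1`, where the Jacobian is that of `r` and
  -- vanishes.
  obtain ⟨s, hsδ, hs⟩ := (Ioc_infinite hδ).exists_subset_card_eq (finrank ℝ E + 1)
  have hint : ∀ t : ℝ, IntegrableOn (fun x => (1 + t • D x).det) B μ := fun t =>
    (ContinuousLinearMap.continuous_det.comp
      (continuous_const.add (hDc.const_smul t))).continuousOn.integrableOn_compact hBc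
  have hzero : ∫ x in B, (1 + D x).det ∂μ = 0 := by
    have h : ∀ x, (1 + D x).det = 0 := fun x => by
      simpa [D] using det_fderiv_eq_zero_of_norm_eq hR (hr.differentiable one_ne_zero) hrR x
    simp [h]
  have hsum : ∫ x in B, (1 + D x).det ∂μ = μ.real B := by
    simp_rw [det_one_add_eq_sum_lagrange s (hs ▸ Nat.lt_succ_self _) (D _)]
    rw [integral_finsetSum _ fun t _ => (hint t).mul_const _]
    simp_rw [integral_mul_const]
    rw [Finset.sum_congr rfl fun t ht => by rw [hvol t (hsδ ht)], ← Finset.mul_sum,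
      ← Polynomial.eval_finsetSum, Lagrange.sum_basis (injOn_id _)
        (Finset.card_pos.1 (hs ▸ Nat.succ_pos _)), Polynomial.eval_one, mul_one]
  have hBpos : 0 < μ.real B :=
    ENNReal.toReal_pos (measure_closedBall_pos μ 0 hR).ne' hBc.measure_ne_top
  exact hBpos.ne' (hsum.symm.trans hzero)

/-- **Brouwer's fixed point theorem**, for smooth self-maps of the unit ball. -/
theorem exists_fixedPoint_of_contDiff [InnerProductSpace ℝ E] [FiniteDimensional ℝ E]
    {f : E → E} (hf : ContDiff ℝ 1 f) (hf1 : ∀ x, ‖f x‖ ≤ 1) : ∃ x, f x = x := by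
  by_contra! hne
  -- The cutoff is `1` on the unit ball, where any zero of `h` must lie, and `0` from radius `2` on.
  -- Hence `h` never vanishes, and it is the identity on the sphere of radius `2`, onto which it is
  -- normalised.
  let χ : ContDiffBump (0 : E) := ⟨1, 2, one_pos, one_lt_two⟩
  let h : E → E := fun x => x - χ x • f x
  have hh : ContDiff ℝ 1 h := contDiff_id.sub (χ.contDiff.smul hf)
  have hh0 : ∀ x, h x ≠ 0 := by
    intro x hx
    have hx' : x = χ x • f x := sub_eq_zero.1 hx
    have hx1 : ‖x‖ ≤ 1 := by
      rw [hx', norm_smul, Real.norm_of_nonneg χ.nonneg]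
      exact mul_le_one₀ χ.le_one (norm_nonneg _) (hf1 x)
    have hχ : χ x = 1 := χ.one_of_mem_closedBall (by simpa using hx1)
    rw [hχ, one_smul] at hx'
    exact hne x hx'.symm
  refine no_retraction_onto_sphere (r := fun x => (2 * ‖h x‖⁻¹) • h x) two_pos ?_ ?_ ?_
  · exact (contDiff_const.mul ((hh.norm ℝ hh0).inv fun x => norm_ne_zero_iff.2 (hh0 x))).smul hh
  · intro x
    have := norm_ne_zero_iff.2 (hh0 x)
    rw [norm_smul, norm_mul, norm_inv, norm_norm, mul_assoc, inv_mul_cancel₀ this]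
    simp
  · intro x hx
    have hχ : χ x = 0 := χ.zero_of_le_dist (by simp [χ, hx])
    simp [h, hχ, hx]

/-- **Brouwer's fixed point theorem**, for continuous maps into the unit ball. -/
theorem exists_fixedPoint_of_continuous [InnerProductSpace ℝ E] [FiniteDimensional ℝ E]
    {f : E → E} (hf : Continuous f) (hf1 : ∀ x, ‖f x‖ ≤ 1) : ∃ x, f x = x := by
  have happrox : ∀ ε > 0, ∃ x ∈ closedBall (0 : E) 1, dist (f x) x < ε := by
    intro ε hε
    -- The target sets are convex, so a `C¹` approximation of `f` can be kept inside the unit ball.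
    obtain ⟨g, hg⟩ := exists_contMDiffMap_forall_mem_convex_of_local_const (n := 1) 𝓘(ℝ, E)
      (t := fun x => ball (f x) ε ∩ closedBall (0 : E) 1)
      (fun x => (convex_ball _ _).inter (convex_closedBall _ _)) (fun x => ⟨f x, by
        filter_upwards [hf.continuousAt (ball_mem_nhds (f x) hε)] with y hy
        exact ⟨mem_ball_comm.1 hy, by simpa using hf1 x⟩⟩)
    obtain ⟨x, hx⟩ := exists_fixedPoint_of_contDiff g.contMDiff.contDiff
      fun x => by simpa using (hg x).2
    have h := hg x
    rw [hx] at h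
    exact ⟨x, h.2, mem_ball'.1 h.1⟩
  have hne : (closedBall (0 : E) 1).Nonempty := ⟨0, by simp⟩
  obtain ⟨x, -, hmin⟩ := (isCompact_closedBall (0 : E) 1).exists_isMinOn hne
    (hf.dist continuous_id).continuousOn
  refine ⟨x, dist_le_zero.1 (le_of_forall_pos_le_add fun ε hε => ?_)⟩
  obtain ⟨y, hy, hyε⟩ := happrox ε hε
  rw [zero_add]
  exact (hmin hy).trans hyε.le

end Brouwer

end ThreePointBVP

namespace ThreePointBVP

open Metric

/-! ### Schauder's and Krasnosel'skii's fixed point theorems. -/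

section Schauder

variable {V : Type*} [NormedAddCommGroup V] [NormedSpace ℝ V]

/-- A continuous map of `ℝ^ι` into the convex set `C` which restricts on the standard simplex to
`y ↦ ∑ i, y i • p i`. -/
theorem exists_continuous_extension_of_simplex {ι : Type*} [Fintype ι] {C : Set V}
    (hC : Convex ℝ C) {x₀ : V} (hx₀ : x₀ ∈ C) {p : ι → V} (hp : ∀ i, p i ∈ C) :
    ∃ P : EuclideanSpace ℝ ι → V, Continuous P ∧ (∀ y, P y ∈ C) ∧
      ∀ y, (∀ i, 0 ≤ y i) → ∑ i, y i = 1 → P y = ∑ i, y i • p i := by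
  let S : EuclideanSpace ℝ ι → ℝ := fun y => ∑ i, |y i|
  have hS : Continuous S := by fun_prop
  have hm : ∀ y, max 1 (S y) ≠ 0 := fun y => (zero_lt_one.trans_le (le_max_left _ _)).ne'
  -- The weights `max (1 - S y) 0` and `|y i|` add up to `max 1 (S y)`; the weight of `x₀`
  -- disappears on the simplex.
  refine ⟨fun y => (max 1 (S y))⁻¹ • (max (1 - S y) 0 • x₀ + ∑ i, |y i| • p i), ?_, ?_, ?_⟩
  · exact ((continuous_const.max hS).inv₀ hm).smul (by fun_prop)
  · intro y
    have hw := hC.sum_mem (t := Finset.univ)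
      (w := fun o : Option ι => (max 1 (S y))⁻¹ * o.elim (max (1 - S y) 0) fun i => |y i|)
      (z := fun o : Option ι => o.elim x₀ p) ?_ ?_ ?_
    · simpa [Fintype.sum_option, smul_add, Finset.smul_sum, mul_smul] using hw
    · rintro (_ | i) - <;> simp only [Option.elim] <;> positivity
    · rw [← Finset.mul_sum, Fintype.sum_option]
      have h : max (1 - S y) 0 + S y = max 1 (S y) := by rw [max_add]; simp
      exact (congrArg _ h).trans (inv_mul_cancel₀ (hm y))
    · rintro (_ | i) -
      exacts [hx₀, hp i]
  · intro y hy h1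
    have hSy : S y = 1 := by simp only [S, abs_of_nonneg (hy _), h1]
    simp [hSy, abs_of_nonneg (hy _)]

/-- Schauder projection: a finite `ε`-net of the image carries a partition of unity, which replaces
`F` by a map between simplex coordinates, where Brouwer's theorem applies. -/
theorem exists_dist_lt_of_mapsTo_totallyBounded {C : Set V} (hC : Convex ℝ C) (hne : C.Nonempty)
    {F : V → V} (hF : ContinuousOn F C) (hFC : MapsTo F C C) (hS : TotallyBounded (F '' C))
    {ε : ℝ} (hε : 0 < ε) : ∃ x ∈ C, dist (F x) x ≤ ε := by
  obtain ⟨k, hk, hkfin, hcov⟩ := hS.exists_subset (dist_mem_uniformity hε)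
  obtain ⟨x₀, hx₀⟩ := hne
  have : Fintype k := hkfin.fintype
  have hkC : ∀ i : k, (i : V) ∈ C := fun i => hFC.image_subset (hk i.2)
  obtain ⟨P, hP, hPC, hPs⟩ := exists_continuous_extension_of_simplex hC hx₀ hkC
  let φ : V → k → ℝ := fun z i => max 0 (ε - dist (F z) i)
  have hφ0 : ∀ z i, 0 ≤ φ z i := fun z i => le_max_left _ _
  have hφP : ∀ i, Continuous fun y => φ (P y) i := fun i =>
    continuous_const.max (continuous_const.sub
      ((hF.comp_continuous hP hPC).dist continuous_const))
  have hpos : ∀ y, 0 < ∑ i, φ (P y) i := by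
    intro y
    have h := hcov (mem_image_of_mem F (hPC y))
    simp only [mem_iUnion] at h
    obtain ⟨i, hi, hdi⟩ := h
    exact Finset.sum_pos' (fun i _ => hφ0 _ i)
      ⟨⟨i, hi⟩, Finset.mem_univ _, lt_max_of_lt_right (sub_pos.2 hdi)⟩
  let G : EuclideanSpace ℝ k → EuclideanSpace ℝ k := fun y =>
    WithLp.toLp 2 fun i => φ (P y) i / ∑ j, φ (P y) j
  have hG : Continuous G := (PiLp.continuous_toLp 2 _).comp <| continuous_pi fun i =>
    (hφP i).div (continuous_finsetSum _ fun j _ => hφP j) fun y => (hpos y).ne'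
  have hG0 : ∀ y i, 0 ≤ G y i := fun y i => div_nonneg (hφ0 _ i) (hpos y).le
  have hGs : ∀ y, ∑ i, G y i = 1 := fun y => by
    simp only [G]
    rw [← Finset.sum_div, div_self (hpos y).ne']
  have hG1 : ∀ y, ‖G y‖ ≤ 1 := by
    intro y
    rw [EuclideanSpace.norm_eq, Real.sqrt_le_one, ← hGs y]
    refine Finset.sum_le_sum fun i _ => ?_
    have hi : G y i ≤ 1 := hGs y ▸ Finset.single_le_sum (fun j _ => hG0 y j) (Finset.mem_univ i)
    rw [Real.norm_of_nonneg (hG0 y i), sq]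
    exact mul_le_of_le_one_left (hG0 y i) hi
  obtain ⟨y, hy⟩ := exists_fixedPoint_of_continuous hG hG1
  have hy0 : ∀ i, 0 ≤ y i := fun i => hy ▸ hG0 y i
  have hys : ∑ i, y i = 1 := (congrArg (fun z : EuclideanSpace ℝ k => ∑ i, z i) hy).symm.trans
    (hGs y)
  refine ⟨P y, hPC y, ?_⟩
  -- The fixed coordinates express `P y` as a convex combination of net points, and only those
  -- within `ε` of `F (P y)` have nonzero weight.
  have hsub : F (P y) - P y = ∑ i, y i • (F (P y) - i) := by
    simp_rw [smul_sub, Finset.sum_sub_distrib, ← Finset.sum_smul, hys, one_smul, ← hPs y hy0 hys]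
  rw [dist_eq_norm, hsub]
  calc ‖∑ i, y i • (F (P y) - i)‖ ≤ ∑ i, y i * ε := by
        refine norm_sum_le_of_le _ fun i _ => ?_
        rw [norm_smul, Real.norm_of_nonneg (hy0 i), ← dist_eq_norm]
        rcases le_or_gt (dist (F (P y)) i) ε with h | h
        · exact mul_le_mul_of_nonneg_left h (hy0 i)
        · have hz : y i = 0 := by
            rw [← hy]
            simp [G, φ, max_eq_left (sub_nonpos.2 h.le)]
          simp [hz]
    _ = ε := by rw [← Finset.sum_mul, hys, one_mul]

/-- **Schauder's fixed point theorem**. -/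
theorem exists_fixedPoint_of_mapsTo_convex {C S : Set V} (hC : Convex ℝ C) (hCc : IsClosed C)
    (hne : C.Nonempty) {F : V → V} (hF : ContinuousOn F C) (hFC : MapsTo F C C)
    (hS : IsCompact S) (hFS : MapsTo F C S) : ∃ x ∈ C, F x = x := by
  have hex : ∀ n : ℕ, ∃ x ∈ C, dist (F x) x ≤ 1 / ((n : ℝ) + 1) := fun n =>
    exists_dist_lt_of_mapsTo_totallyBounded hC hne hF hFC
      (hS.totallyBounded.subset hFS.image_subset) Nat.one_div_pos_of_nat
  choose x hxC hx using hex
  obtain ⟨z, -, ψ, hψ, hz⟩ := hS.tendsto_subseq fun n => hFS (hxC n)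
  have hd : Tendsto (fun n => dist (F (x (ψ n))) (x (ψ n))) atTop (𝓝 0) :=
    squeeze_zero (fun _ => dist_nonneg) (fun n => hx (ψ n))
      (tendsto_one_div_add_atTop_nhds_zero_nat.comp hψ.tendsto_atTop)
  have hxz : Tendsto (fun n => x (ψ n)) atTop (𝓝 z) := hz.congr_dist hd
  have hzC : z ∈ C := hCc.mem_of_tendsto hxz (Eventually.of_forall fun n => hxC _)
  refine ⟨z, hzC, tendsto_nhds_unique ?_ hz⟩
  exact (hF z hzC).tendsto.comp
    (tendsto_nhdsWithin_iff.2 ⟨hxz, Eventually.of_forall fun n => hxC _⟩)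

/-- **Krasnosel'skii's fixed point theorem**, compressive case: in a closed cone on which the norm
is monotone, a compact map that increases the norm near `0` and does not increase it near infinity
has a nonzero fixed point. -/
theorem exists_fixedPoint_of_cone_compression {K : ConvexCone ℝ V} (hK : IsClosed (K : Set V))
    (hmono : ∀ u ∈ K, ∀ v ∈ K, ‖u‖ ≤ ‖u + v‖) {e : V} (he : e ∈ K) (he0 : e ≠ 0)
    (h0K : (0 : V) ∈ K) {A : V → V}
    (hA : ContinuousOn A K) (hAK : MapsTo A K K)
    (hcomp : ∀ M, ∃ S, IsCompact S ∧ MapsTo A (K ∩ closedBall 0 M) S)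
    {r R : ℝ} (hr : 0 < r) (hsmall : ∀ u ∈ K, u ≠ 0 → ‖u‖ < r → ‖u‖ < ‖A u‖)
    (hlarge : ∀ u ∈ K, R ≤ ‖u‖ → ‖A u‖ ≤ ‖u‖) : ∃ u ∈ K, u ≠ 0 ∧ A u = u := by
  have hsmul : ∀ t : ℝ, 0 ≤ t → t • e ∈ K := fun t ht => by
    rcases ht.eq_or_lt with rfl | ht
    · rwa [zero_smul]
    · exact K.smul_mem ht he
  -- The push along `e` acts only for `‖u‖ < r`. It removes the fixed point `0` and, the norm being
  -- monotone on the cone, creates no other one there.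
  let B : V → V := fun u => A u + max (r - ‖u‖) 0 • e
  have hBA : ∀ u, r ≤ ‖u‖ → B u = A u := fun u hu => by simp [B, max_eq_right (sub_nonpos.2 hu)]
  have hB : ContinuousOn B K := hA.add (by fun_prop)
  have hBK : MapsTo B K K := fun u hu => K.add_mem (hAK hu) (hsmul _ (le_max_right _ _))
  have hBle : ∀ u, ‖B u‖ ≤ ‖A u‖ + r * ‖e‖ := fun u => by
    refine (norm_add_le _ _).trans (add_le_add_right ?_ _)
    rw [norm_smul, Real.norm_of_nonneg (le_max_right _ _)]
    exact mul_le_mul_of_nonneg_right (max_le (sub_le_self _ (norm_nonneg _)) hr.le)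
      (norm_nonneg _)
  obtain ⟨S₀, hS₀, hAS₀⟩ := hcomp (max R r)
  obtain ⟨b, hb⟩ := hS₀.isBounded.exists_norm_le
  -- The second term bounds `B` on the ball of radius `max R r`; beyond that radius `B = A` does not
  -- increase the norm.
  let M := max (max R r) (b + r * ‖e‖)
  have hMmap : MapsTo B (K ∩ closedBall 0 M) (K ∩ closedBall 0 M) := by
    rintro u ⟨hu, huM⟩
    refine ⟨hBK hu, ?_⟩
    rw [mem_closedBall_zero_iff] at huM ⊢
    rcases le_total ‖u‖ (max R r) with h | h
    · have h1 := hb _ (hAS₀ ⟨hu, mem_closedBall_zero_iff.2 h⟩)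
      exact (hBle u).trans ((add_le_add_left h1 _).trans (le_max_right _ _))
    · rw [hBA u ((le_max_right _ _).trans h)]
      exact (hlarge u hu ((le_max_left _ _).trans h)).trans huM
  obtain ⟨S, hS, hAS⟩ := hcomp M
  have hScomp : IsCompact ((fun q : V × ℝ => q.1 + q.2 • e) '' (S ×ˢ Icc 0 r)) :=
    (hS.prod isCompact_Icc).image (by fun_prop)
  obtain ⟨u, ⟨huK, -⟩, hu⟩ := exists_fixedPoint_of_mapsTo_convex
    (K.convex.inter (convex_closedBall 0 M)) (hK.inter isClosed_closedBall)
    ⟨0, h0K, mem_closedBall_self (hr.le.trans ((le_max_right _ _).trans (le_max_left _ _)))⟩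
    (hB.mono inter_subset_left) hMmap hScomp
    (fun u hu => ⟨(A u, max (r - ‖u‖) 0), ⟨hAS hu, le_max_right _ _,
      max_le (sub_le_self _ (norm_nonneg _)) hr.le⟩, rfl⟩)
  have hur : r ≤ ‖u‖ := by
    by_contra! h
    by_cases hu0 : u = 0
    · have h1 := hmono _ (hsmul r hr.le) _ (hAK h0K)
      have h2 : r • e + A 0 = 0 := by
        rw [hu0] at hu
        simpa [B, hr.le, add_comm] using hu
      rw [h2, norm_zero, norm_le_zero_iff] at h1
      exact (smul_ne_zero hr.ne' he0) h1
    · have h1 := hmono _ (hAK huK) _ (hsmul _ (le_max_right (r - ‖u‖) 0))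
      have h2 : ‖A u‖ ≤ ‖B u‖ := h1
      rw [hu] at h2
      exact (hsmall u huK hu0 h).not_ge h2
  exact ⟨u, huK, norm_pos_iff.1 (hr.trans_le hur), hBA u hur ▸ hu⟩

/-- **Krasnosel'skii's fixed point theorem**, expansive case. -/
theorem exists_fixedPoint_of_cone_expansion {K : ConvexCone ℝ V} (hK : IsClosed (K : Set V))
    (hmono : ∀ u ∈ K, ∀ v ∈ K, ‖u‖ ≤ ‖u + v‖) {e : V} (he : e ∈ K) (he1 : ‖e‖ = 1)
    (h0K : (0 : V) ∈ K) {A : V → V} (hA : ContinuousOn A K) (hAK : MapsTo A K K)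
    (hcomp : ∀ M, ∃ S, IsCompact S ∧ MapsTo A (K ∩ closedBall 0 M) S)
    {r R : ℝ} (hr : 0 < r) (hsmall : ∀ u ∈ K, u ≠ 0 → ‖u‖ < r → ‖A u‖ < ‖u‖)
    (hlarge : ∀ u ∈ K, R ≤ ‖u‖ → ‖u‖ ≤ ‖A u‖) : ∃ u ∈ K, u ≠ 0 ∧ A u = u := by
  have hsmul : ∀ t : ℝ, 0 ≤ t → ∀ v ∈ K, t • v ∈ K := fun t ht v hv => by
    rcases ht.eq_or_lt with rfl | ht
    · rwa [zero_smul]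
    · exact K.smul_mem ht hv
  -- Keep the values away from zero, then invert radially to reduce to the compressive case.
  let θ : V → ℝ := fun u => max (‖u‖ / 2 - ‖A u‖) 0
  have hθ0 : ∀ u, 0 ≤ θ u := fun u => le_max_right _ _
  let Q : V → V := fun u => A u + θ u • e
  have hθe : ∀ u, ‖θ u • e‖ = θ u := fun u => by
    rw [norm_smul, Real.norm_of_nonneg (hθ0 u), he1, mul_one]
  have hQK : MapsTo Q K K := fun u hu => K.add_mem (hAK hu) (hsmul _ (hθ0 u) _ he)
  have hθc : ContinuousOn θ K :=
    ((continuousOn_id.norm.div_const 2).sub hA.norm).sup continuousOn_const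
  have hQ : ContinuousOn Q K := hA.add (hθc.smul continuousOn_const)
  have hAQ : ∀ u ∈ K, ‖A u‖ ≤ ‖Q u‖ := fun u hu => hmono _ (hAK hu) _ (hsmul _ (hθ0 u) _ he)
  have hθQ : ∀ u ∈ K, θ u ≤ ‖Q u‖ := fun u hu => by
    have h := hmono _ (hsmul _ (hθ0 u) _ he) _ (hAK hu)
    rwa [hθe, add_comm] at h
  have hQlow : ∀ u ∈ K, ‖u‖ / 4 ≤ ‖Q u‖ := fun u hu => by
    have h1 := hAQ u hu
    have h2 := hθQ u hu
    have h3 : ‖u‖ / 2 - ‖A u‖ ≤ θ u := le_max_left _ _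
    linarith
  have hQup : ∀ u, ‖Q u‖ ≤ max (‖A u‖) (‖u‖ / 2) := fun u => by
    have h1 : ‖Q u‖ ≤ ‖A u‖ + θ u := (norm_add_le _ _).trans_eq (by rw [hθe])
    refine h1.trans_eq ?_
    simp only [θ]
    rw [← max_add_add_left, add_sub_cancel, add_zero, max_comm]
  -- With this factor `‖B u‖ = ‖u‖ ^ 2 / ‖Q u‖` for `u ≠ 0`, so expansion and compression are
  -- exchanged while nonzero fixed points of `B` are fixed by `Q`.
  let s : V → ℝ := fun u => (‖u‖ / ‖Q u‖) ^ 2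
  have hs0 : ∀ u, 0 ≤ s u := fun u => sq_nonneg _
  have hs16 : ∀ u ∈ K, s u ≤ 16 := fun u hu => by
    have h : ‖u‖ / ‖Q u‖ ≤ 4 :=
      div_le_of_le_mul₀ (norm_nonneg _) (by norm_num) (by linarith [hQlow u hu])
    calc s u ≤ 4 ^ 2 := pow_le_pow_left₀ (by positivity) h 2
      _ = 16 := by norm_num
  let B : V → V := fun u => s u • Q u
  have hQpos : ∀ u ∈ K, u ≠ 0 → 0 < ‖Q u‖ := fun u hu hu0 =>
    (div_pos (norm_pos_iff.2 hu0) (by norm_num)).trans_le (hQlow u hu)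
  have hBn : ∀ u ∈ K, u ≠ 0 → ‖B u‖ = ‖u‖ * (‖u‖ / ‖Q u‖) := fun u hu hu0 => by
    have := (hQpos u hu hu0).ne'
    simp only [B, s]
    rw [norm_smul, Real.norm_of_nonneg (sq_nonneg _)]
    field_simp
  have hB4 : ∀ u ∈ K, ‖B u‖ ≤ 4 * ‖u‖ := fun u hu => by
    by_cases hu0 : u = 0
    · simp [B, s, hu0]
    · rw [hBn u hu hu0, mul_comm]
      exact mul_le_mul_of_nonneg_right
        (div_le_of_le_mul₀ (norm_nonneg _) (by norm_num) (by linarith [hQlow u hu]))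
        (norm_nonneg _)
  have hB : ContinuousOn B K := by
    intro u hu
    -- At `0` the quotient in `s` takes the value `0`, and continuity comes from `‖B u‖ ≤ 4 * ‖u‖`.
    by_cases hu0 : u = 0
    · subst hu0
      have hB0 : B 0 = 0 := by simp [B, s]
      rw [ContinuousWithinAt, hB0]
      refine squeeze_zero_norm' (eventually_mem_nhdsWithin.mono hB4) ?_
      have : Tendsto (fun v : V => 4 * ‖v‖) (𝓝 0) (𝓝 (4 * ‖(0 : V)‖)) :=
        (continuous_const.mul continuous_norm).tendsto _
      rw [norm_zero, mul_zero] at this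
      exact this.mono_left nhdsWithin_le_nhds
    · exact ((continuousWithinAt_id.norm.div (hQ u hu).norm (hQpos u hu hu0).ne').pow 2).smul
        (hQ u hu)
  have hfix : ∃ u ∈ K, u ≠ 0 ∧ B u = u := by
    refine exists_fixedPoint_of_cone_compression hK hmono he
      (norm_ne_zero_iff.1 (he1 ▸ one_ne_zero)) h0K hB
      (fun u hu => hsmul _ (hs0 u) _ (hQK hu)) ?_ hr ?_ (R := max R 1) ?_
    · intro M
      obtain ⟨S, hS, hAS⟩ := hcomp M
      refine ⟨(fun q : ℝ × V × ℝ => q.1 • (q.2.1 + q.2.2 • e)) '' (Icc 0 16 ×ˢ S ×ˢ Icc 0 (|M| / 2)),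
        (isCompact_Icc.prod (hS.prod isCompact_Icc)).image (by fun_prop), ?_⟩
      intro u hu
      refine ⟨(s u, A u, θ u), ⟨⟨hs0 u, hs16 u hu.1⟩, hAS hu, hθ0 u, max_le ?_ (by positivity)⟩, rfl⟩
      have h1 := mem_closedBall_zero_iff.1 hu.2
      linarith [norm_nonneg (A u), le_abs_self M]
    · intro u hu hu0 hur
      have hlt : ‖Q u‖ < ‖u‖ := (hQup u).trans_lt
        (max_lt (hsmall u hu hu0 hur) (half_lt_self (norm_pos_iff.2 hu0)))
      rw [hBn u hu hu0]
      exact lt_mul_of_one_lt_right (norm_pos_iff.2 hu0) ((one_lt_div (hQpos u hu hu0)).2 hlt)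
    · intro u hu hR
      have hu0 : u ≠ 0 := norm_pos_iff.1 (one_pos.trans_le ((le_max_right _ _).trans hR))
      rw [hBn u hu hu0]
      exact mul_le_of_le_one_right (norm_nonneg _) ((div_le_one (hQpos u hu hu0)).2
        ((hlarge u hu ((le_max_left _ _).trans hR)).trans (hAQ u hu)))
  obtain ⟨u, huK, hu0, hu⟩ := hfix
  have hun : ‖u‖ ≠ 0 := norm_ne_zero_iff.2 hu0
  have h1 := hBn u huK hu0
  rw [hu] at h1
  have h2 : ‖u‖ / ‖Q u‖ = 1 := mul_left_cancel₀ hun (by rw [← h1, mul_one])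
  have h3 : Q u = u := by
    have h4 : B u = Q u := by simp only [B, s, h2, one_pow, one_smul]
    rw [← h4, hu]
  refine ⟨u, huK, hu0, ?_⟩
  -- If `Q u = u ≠ 0`, the bound on `‖Q u‖` forces `‖u‖ ≤ ‖A u‖`; then the correction `θ u` is zero
  -- and `u` is fixed by `A`.
  have h5 := hQup u
  rw [h3] at h5
  have h6 : ‖u‖ / 2 < ‖u‖ := half_lt_self (norm_pos_iff.2 hu0)
  have h7 : ‖u‖ ≤ ‖A u‖ := (le_max_iff.1 h5).resolve_right h6.not_ge
  have h8 : θ u = 0 := max_eq_right (by linarith)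
  simpa only [Q, h8, zero_smul, add_zero] using h3

end Schauder

end ThreePointBVP

namespace ThreePointBVP

open intervalIntegral

/-! ### The Dirichlet problem through its Green function. -/

section LinearProblem

/-- The solution of `w'' = -y`, `w 0 = w T = 0`. -/
noncomputable def dirichletSol (T : ℝ) (y : ℝ → ℝ) (t : ℝ) : ℝ :=
  ((T - t) * (∫ s in (0 : ℝ)..t, s * y s) + t * ∫ s in t..T, (T - s) * y s) / T

/-- The derivative of `dirichletSol`. -/
noncomputable def dirichletDeriv (T : ℝ) (y : ℝ → ℝ) (t : ℝ) : ℝ :=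
  ((∫ s in t..T, (T - s) * y s) - ∫ s in (0 : ℝ)..t, s * y s) / T

variable {T : ℝ} {y : ℝ → ℝ}

theorem hasDerivAt_integral_id_mul (hy : Continuous y) (t : ℝ) :
    HasDerivAt (fun t => ∫ s in (0 : ℝ)..t, s * y s) (t * y t) t := by
  have hc : Continuous fun s => s * y s := continuous_id.mul hy
  exact integral_hasDerivAt_right (hc.intervalIntegrable _ _)
    hc.stronglyMeasurable.stronglyMeasurableAtFilter hc.continuousAt

theorem hasDerivAt_integral_sub_mul (hy : Continuous y) (t : ℝ) :
    HasDerivAt (fun t => ∫ s in t..T, (T - s) * y s) (-((T - t) * y t)) t := by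
  have hc : Continuous fun s => (T - s) * y s := by fun_prop
  exact integral_hasDerivAt_left (hc.intervalIntegrable _ _)
    hc.stronglyMeasurable.stronglyMeasurableAtFilter hc.continuousAt

theorem hasDerivAt_dirichletSol (hy : Continuous y) (t : ℝ) :
    HasDerivAt (dirichletSol T y) (dirichletDeriv T y t) t := by
  have h := ((((hasDerivAt_id t).const_sub T).mul (hasDerivAt_integral_id_mul hy t)).add
    ((hasDerivAt_id t).mul (hasDerivAt_integral_sub_mul (T := T) hy t))).div_const T
  refine h.congr_deriv ?_
  simp only [dirichletDeriv, id]
  ring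

theorem hasDerivAt_dirichletDeriv (hT : T ≠ 0) (hy : Continuous y) (t : ℝ) :
    HasDerivAt (dirichletDeriv T y) (-y t) t := by
  have h := ((hasDerivAt_integral_sub_mul (T := T) hy t).sub
    (hasDerivAt_integral_id_mul hy t)).div_const T
  refine h.congr_deriv ?_
  field_simp
  ring

theorem continuous_dirichletSol (hy : Continuous y) : Continuous (dirichletSol T y) :=
  continuous_iff_continuousAt.2 fun t => (hasDerivAt_dirichletSol hy t).continuousAt

theorem dirichletSol_zero : dirichletSol T y 0 = 0 := by simp [dirichletSol]

theorem dirichletSol_right : dirichletSol T y T = 0 := by simp [dirichletSol]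

theorem dirichletSol_add {z : ℝ → ℝ} (hy : Continuous y) (hz : Continuous z) (t : ℝ) :
    dirichletSol T (fun s => y s + z s) t = dirichletSol T y t + dirichletSol T z t := by
  simp only [dirichletSol, mul_add]
  rw [integral_add (Continuous.intervalIntegrable (by fun_prop) _ _)
      (Continuous.intervalIntegrable (by fun_prop) _ _),
    integral_add (Continuous.intervalIntegrable (by fun_prop) _ _)
      (Continuous.intervalIntegrable (by fun_prop) _ _)]
  ring

theorem dirichletSol_const_mul (c t : ℝ) :
    dirichletSol T (fun s => c * y s) t = c * dirichletSol T y t := by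
  simp only [dirichletSol, mul_left_comm _ c, integral_const_mul]
  ring

theorem dirichletSol_nonneg (hT : 0 < T) (hy0 : ∀ s ∈ Icc 0 T, 0 ≤ y s) {t : ℝ}
    (ht : t ∈ Icc 0 T) : 0 ≤ dirichletSol T y t := by
  refine div_nonneg (add_nonneg (mul_nonneg (sub_nonneg.2 ht.2) ?_) (mul_nonneg ht.1 ?_)) hT.le
  · exact integral_nonneg ht.1 fun s hs => mul_nonneg hs.1 (hy0 s ⟨hs.1, hs.2.trans ht.2⟩)
  · exact integral_nonneg ht.2 fun s hs =>
      mul_nonneg (sub_nonneg.2 hs.2) (hy0 s ⟨ht.1.trans hs.1, hs.2⟩)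

/-- A Harnack-type inequality for the Dirichlet problem. -/
theorem dirichletSol_harnack (hT : 0 < T) (hy : Continuous y) (hy0 : ∀ s ∈ Icc 0 T, 0 ≤ y s)
    {t τ : ℝ} (ht : t ∈ Icc 0 T) (hτ : τ ∈ Icc 0 T) :
    t * (T - t) / T ^ 2 * dirichletSol T y τ ≤ dirichletSol T y t := by
  have hi : ∀ b c, IntervalIntegrable (fun s => s * y s) MeasureTheory.volume b c := fun b c =>
    Continuous.intervalIntegrable (by fun_prop) b c
  have hj : ∀ b c, IntervalIntegrable (fun s => (T - s) * y s) MeasureTheory.volume b c :=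
    fun b c => Continuous.intervalIntegrable (by fun_prop) b c
  have hleft : ∀ b c, 0 ≤ b → b ≤ c → c ≤ T → 0 ≤ ∫ s in b..c, s * y s := fun b c hb hbc hc =>
    integral_nonneg hbc fun s hs => mul_nonneg (hb.trans hs.1) (hy0 s ⟨hb.trans hs.1, hs.2.trans hc⟩)
  have hright : ∀ b c, 0 ≤ b → b ≤ c → c ≤ T → 0 ≤ ∫ s in b..c, (T - s) * y s :=
    fun b c hb hbc hc => integral_nonneg hbc fun s hs =>
      mul_nonneg (sub_nonneg.2 (hs.2.trans hc)) (hy0 s ⟨hb.trans hs.1, hs.2.trans hc⟩)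
  have hsum : ∀ b c, (∫ s in b..c, s * y s) + (∫ s in b..c, (T - s) * y s)
      = T * ∫ s in b..c, y s := by
    intro b c
    rw [← integral_add (hi b c) (hj b c), ← integral_const_mul]
    congr 1
    funext s
    ring
  have hk : 0 ≤ T - t := sub_nonneg.2 ht.2
  have hk' : 0 ≤ T - τ := sub_nonneg.2 hτ.2
  rw [← sub_nonneg]
  -- Splitting the integrals at `t` and `τ` leaves manifestly nonnegative outer pieces. In the
  -- middle piece the two kernels differ, and are compared pointwise.
  rcases le_total t τ with h | h
  · have e1 := integral_add_adjacent_intervals (hi 0 t) (hi t τ)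
    have e2 := integral_add_adjacent_intervals (hj t τ) (hj τ T)
    have p1 := hleft 0 t le_rfl ht.1 ht.2
    have p2 := hleft t τ ht.1 h hτ.2
    have p3 := hright t τ ht.1 h hτ.2
    have p4 := hright τ T hτ.1 hτ.2 le_rfl
    have key : dirichletSol T y t - t * (T - t) / T ^ 2 * dirichletSol T y τ =
        ((T - t) * (T ^ 2 - t * (T - τ)) * (∫ s in (0 : ℝ)..t, s * y s)
          + (t * T ^ 2 * (∫ s in t..τ, (T - s) * y s)
            - t * (T - t) * (T - τ) * (∫ s in t..τ, s * y s))
          + t * (T ^ 2 - (T - t) * τ) * (∫ s in τ..T, (T - s) * y s)) / T ^ 3 := by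
      simp only [dirichletSol]
      rw [← e1, ← e2]
      field_simp
      ring
    rw [key]
    refine div_nonneg (add_nonneg (add_nonneg (mul_nonneg (mul_nonneg hk ?_) p1) ?_)
      (mul_nonneg (mul_nonneg ht.1 ?_) p4)) (by positivity)
    · nlinarith [ht.1, ht.2, hτ.1, hτ.2]
    · have hcmp : (T - τ) * (∫ s in t..τ, s * y s) ≤ T * ∫ s in t..τ, (T - s) * y s := by
        rw [← integral_const_mul, ← integral_const_mul]
        refine integral_mono_on h ((hi t τ).const_mul _) ((hj t τ).const_mul _) fun s hs => ?_
        have h1 := hy0 s ⟨ht.1.trans hs.1, hs.2.trans hτ.2⟩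
        rw [← mul_assoc, ← mul_assoc]
        refine mul_le_mul_of_nonneg_right ?_ h1
        nlinarith [ht.1, hs.1, hs.2, hτ.2]
      have h2 : 0 ≤ (T - τ) * ∫ s in t..τ, s * y s := mul_nonneg hk' p2
      have h3 : (T - t) * ((T - τ) * ∫ s in t..τ, s * y s)
          ≤ T * (T * ∫ s in t..τ, (T - s) * y s) :=
        mul_le_mul (sub_le_self _ ht.1) hcmp h2 hT.le
      nlinarith [mul_le_mul_of_nonneg_left h3 ht.1]
    · nlinarith [ht.1, ht.2, hτ.1, hτ.2]
  · have e1 := integral_add_adjacent_intervals (hi 0 τ) (hi τ t)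
    have e2 := integral_add_adjacent_intervals (hj τ t) (hj t T)
    have p1 := hleft 0 τ le_rfl hτ.1 hτ.2
    have p2 := hleft τ t hτ.1 h ht.2
    have p3 := hright τ t hτ.1 h ht.2
    have p4 := hright t T ht.1 ht.2 le_rfl
    have key : dirichletSol T y t - t * (T - t) / T ^ 2 * dirichletSol T y τ =
        ((T - t) * (T ^ 2 - t * (T - τ)) * (∫ s in (0 : ℝ)..τ, s * y s)
          + (T - t) * (T ^ 2 * (∫ s in τ..t, s * y s)
            - t * (τ * (∫ s in τ..t, (T - s) * y s)))
          + t * (T ^ 2 - (T - t) * τ) * (∫ s in t..T, (T - s) * y s)) / T ^ 3 := by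
      simp only [dirichletSol]
      rw [← e1, ← e2]
      field_simp
      ring
    rw [key]
    refine div_nonneg (add_nonneg (add_nonneg (mul_nonneg (mul_nonneg hk ?_) p1)
      (mul_nonneg hk ?_)) (mul_nonneg (mul_nonneg ht.1 ?_) p4)) (by positivity)
    · nlinarith [ht.1, ht.2, hτ.1, hτ.2]
    · have hcmp : τ * (∫ s in τ..t, (T - s) * y s) ≤ T * ∫ s in τ..t, s * y s := by
        rw [← integral_const_mul, ← integral_const_mul]
        refine integral_mono_on h ((hj τ t).const_mul _) ((hi τ t).const_mul _) fun s hs => ?_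
        have h1 := hy0 s ⟨hτ.1.trans hs.1, hs.2.trans ht.2⟩
        rw [← mul_assoc, ← mul_assoc]
        refine mul_le_mul_of_nonneg_right ?_ h1
        nlinarith [hτ.1, hs.1, hs.2, ht.2]
      have h3 : t * (τ * ∫ s in τ..t, (T - s) * y s) ≤ T * (T * ∫ s in τ..t, s * y s) :=
        mul_le_mul ht.2 hcmp (mul_nonneg hτ.1 p3) hT.le
      nlinarith
    · nlinarith [ht.1, ht.2, hτ.1, hτ.2]

theorem abs_integral_mul_le {g : ℝ → ℝ} {M b c : ℝ} (hM : ∀ s ∈ Icc 0 T, |y s| ≤ M)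
    (hg : ∀ s ∈ Icc 0 T, |g s| ≤ T) (hb : 0 ≤ b) (hbc : b ≤ c) (hc : c ≤ T) :
    |∫ s in b..c, g s * y s| ≤ T ^ 2 * M := by
  have hT : 0 ≤ T := hb.trans (hbc.trans hc)
  have hM0 : 0 ≤ M := (abs_nonneg _).trans (hM 0 ⟨le_rfl, hT⟩)
  have h := norm_integral_le_of_norm_le_const (a := b) (b := c) (f := fun s => g s * y s)
    (C := T * M) fun s hs => by
      rw [uIoc_of_le hbc] at hs
      have hsT : s ∈ Icc 0 T := ⟨hb.trans hs.1.le, hs.2.trans hc⟩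
      rw [Real.norm_eq_abs, abs_mul]
      exact mul_le_mul (hg s hsT) (hM s hsT) (abs_nonneg _) hT
  rw [Real.norm_eq_abs, abs_of_nonneg (sub_nonneg.2 hbc)] at h
  calc _ ≤ T * M * (c - b) := h
    _ ≤ T * M * T := mul_le_mul_of_nonneg_left (by linarith) (by positivity)
    _ = T ^ 2 * M := by ring

theorem abs_dirichletDeriv_le (hT : 0 < T) {M : ℝ} (hM : ∀ s ∈ Icc 0 T, |y s| ≤ M) {t : ℝ}
    (ht : t ∈ Icc 0 T) : |dirichletDeriv T y t| ≤ 2 * T * M := by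
  have h1 := abs_integral_mul_le (g := fun s => T - s) hM
    (fun s hs => abs_le.2 ⟨by linarith [hs.2], by linarith [hs.1]⟩) ht.1 ht.2 le_rfl
  have h2 := abs_integral_mul_le (g := fun s => s) hM
    (fun s hs => abs_le.2 ⟨by linarith [hs.1], hs.2⟩) le_rfl ht.1 ht.2
  rw [dirichletDeriv, abs_div, abs_of_pos hT, div_le_iff₀ hT]
  calc _ ≤ _ := abs_sub _ _
    _ ≤ T ^ 2 * M + T ^ 2 * M := add_le_add h1 h2
    _ = 2 * T * M * T := by ring

theorem abs_dirichletSol_le (hT : 0 < T) {M : ℝ} (hM : ∀ s ∈ Icc 0 T, |y s| ≤ M) {t : ℝ}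
    (ht : t ∈ Icc 0 T) : |dirichletSol T y t| ≤ 2 * T ^ 2 * M := by
  have h1 := abs_integral_mul_le (g := fun s => T - s) hM
    (fun s hs => abs_le.2 ⟨by linarith [hs.2], by linarith [hs.1]⟩) ht.1 ht.2 le_rfl
  have h2 := abs_integral_mul_le (g := fun s => s) hM
    (fun s hs => abs_le.2 ⟨by linarith [hs.1], hs.2⟩) le_rfl ht.1 ht.2
  rw [dirichletSol, abs_div, abs_of_pos hT, div_le_iff₀ hT]
  calc _ ≤ _ := abs_add_le _ _
    _ ≤ T * (T ^ 2 * M) + T * (T ^ 2 * M) := by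
        rw [abs_mul, abs_mul]
        refine add_le_add (mul_le_mul ?_ h2 (abs_nonneg _) hT.le)
          (mul_le_mul ?_ h1 (abs_nonneg _) hT.le)
        · exact abs_le.2 ⟨by linarith [ht.2], by linarith [ht.1]⟩
        · exact abs_le.2 ⟨by linarith [ht.1], ht.2⟩
    _ = 2 * T ^ 2 * M * T := by ring

end LinearProblem

end ThreePointBVP

namespace ThreePointBVP

open intervalIntegral

/-! ### The linear problem with nonlocal boundary conditions. -/

section NonlocalProblem

/-- The boundary values `p = u 0` and `q = u T` of the solution of the linear nonlocal problem
depend linearly, with nonnegative coefficients, on the value at `η` and the integral over `[0, η]`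
of the solution of the Dirichlet problem. -/
theorem exists_boundary_coefficients {T η α β : ℝ} (hη : 0 < η) (hηT : η < T) (hα : 0 < α)
    (hαT : α < 2 * T / η ^ 2) (hβ : 0 ≤ β)
    (hβT : β < (2 * T - α * η ^ 2) / (α * η ^ 2 - 2 * η + 2 * T)) :
    ∃ c₁ c₂ c₃ c₄ : ℝ, 0 ≤ c₁ ∧ 0 ≤ c₂ ∧ 0 ≤ c₃ ∧ 0 ≤ c₄ ∧ ∀ w W : ℝ,
      c₁ * w + c₂ * W
          = β * (w + (c₁ * w + c₂ * W) * (1 - η / T) + (c₃ * w + c₄ * W) * (η / T)) ∧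
      c₃ * w + c₄ * W = α * (W + (c₁ * w + c₂ * W) * (η - η ^ 2 / (2 * T))
          + (c₃ * w + c₄ * W) * (η ^ 2 / (2 * T))) := by
  have hT : 0 < T := hη.trans hηT
  have h1 : 0 < 2 * T - α * η ^ 2 := by
    rw [lt_div_iff₀ (by positivity)] at hαT
    linarith
  have hαη : 0 < α * η ^ 2 := by positivity
  have h2 : β * (α * η ^ 2 - 2 * η + 2 * T) < 2 * T - α * η ^ 2 :=
    (lt_div_iff₀ (by linarith)).1 hβT
  have h3 : 0 < T - β * (T - η) := by nlinarith
  -- `D` is `2 * T` times the determinant of the system for the two boundary values, and the bound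
  -- on `β` says that it is positive. The coefficients below come from Cramer's rule.
  obtain ⟨D, hD⟩ : ∃ D, D = 2 * T - α * η ^ 2 - β * (α * η ^ 2 - 2 * η + 2 * T) := ⟨_, rfl⟩
  have hD0 : 0 < D := by rw [hD]; linarith
  refine ⟨β * (2 * T - α * η ^ 2) / D, 2 * α * β * η / D, α * β * η * (2 * T - η) / D,
    2 * α * (T - β * (T - η)) / D, by positivity, by positivity,
    div_nonneg (mul_nonneg (by positivity) (by linarith)) hD0.le, by positivity, fun w W => ?_⟩
  constructor
  · field_simp
    rw [hD]
    ring
  · field_simp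
    rw [hD]
    ring

/-- The solution of `u'' = -y` with boundary values prescribed in terms of the Dirichlet solution
by the coefficients `c`. -/
noncomputable def bvpSol (T η c₁ c₂ c₃ c₄ : ℝ) (y : ℝ → ℝ) (t : ℝ) : ℝ :=
  dirichletSol T y t
    + (c₁ * dirichletSol T y η + c₂ * ∫ s in (0 : ℝ)..η, dirichletSol T y s) * (1 - t / T)
    + (c₃ * dirichletSol T y η + c₄ * ∫ s in (0 : ℝ)..η, dirichletSol T y s) * (t / T)

variable {T η c₁ c₂ c₃ c₄ : ℝ} {y : ℝ → ℝ}

theorem hasDerivAt_bvpSol (hy : Continuous y) (t : ℝ) :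
    HasDerivAt (bvpSol T η c₁ c₂ c₃ c₄ y) (dirichletDeriv T y t
      + ((c₃ * dirichletSol T y η + c₄ * ∫ s in (0 : ℝ)..η, dirichletSol T y s)
        - (c₁ * dirichletSol T y η + c₂ * ∫ s in (0 : ℝ)..η, dirichletSol T y s)) / T) t := by
  have h := ((hasDerivAt_dirichletSol (T := T) hy t).add
    ((((hasDerivAt_id t).div_const T).const_sub 1).const_mul
      (c₁ * dirichletSol T y η + c₂ * ∫ s in (0 : ℝ)..η, dirichletSol T y s))).add
    (((hasDerivAt_id t).div_const T).const_mul
      (c₃ * dirichletSol T y η + c₄ * ∫ s in (0 : ℝ)..η, dirichletSol T y s))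
  refine h.congr_deriv ?_
  ring

theorem deriv_bvpSol (hy : Continuous y) : deriv (bvpSol T η c₁ c₂ c₃ c₄ y) =
    fun t => dirichletDeriv T y t
      + ((c₃ * dirichletSol T y η + c₄ * ∫ s in (0 : ℝ)..η, dirichletSol T y s)
        - (c₁ * dirichletSol T y η + c₂ * ∫ s in (0 : ℝ)..η, dirichletSol T y s)) / T :=
  funext fun t => (hasDerivAt_bvpSol hy t).deriv

theorem deriv_deriv_bvpSol (hT : T ≠ 0) (hy : Continuous y) :
    deriv (deriv (bvpSol T η c₁ c₂ c₃ c₄ y)) = fun t => -y t := by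
  rw [deriv_bvpSol hy]
  exact funext fun t => ((hasDerivAt_dirichletDeriv hT hy t).add_const _).deriv

theorem contDiff_bvpSol (hT : T ≠ 0) (hy : Continuous y) :
    ContDiff ℝ 2 (bvpSol T η c₁ c₂ c₃ c₄ y) := by
  rw [show (2 : WithTop ℕ∞) = 1 + 1 from one_add_one_eq_two.symm, contDiff_succ_iff_deriv]
  refine ⟨fun t => (hasDerivAt_bvpSol hy t).differentiableAt, by simp, ?_⟩
  rw [contDiff_one_iff_deriv, deriv_deriv_bvpSol hT hy, deriv_bvpSol hy]
  exact ⟨fun t => ((hasDerivAt_dirichletDeriv hT hy t).add_const _).differentiableAt, hy.neg⟩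

theorem bvpSol_zero : bvpSol T η c₁ c₂ c₃ c₄ y 0 =
    c₁ * dirichletSol T y η + c₂ * ∫ s in (0 : ℝ)..η, dirichletSol T y s := by
  simp [bvpSol, dirichletSol_zero]

theorem bvpSol_right (hT : T ≠ 0) : bvpSol T η c₁ c₂ c₃ c₄ y T =
    c₃ * dirichletSol T y η + c₄ * ∫ s in (0 : ℝ)..η, dirichletSol T y s := by
  simp [bvpSol, dirichletSol_right, hT]

theorem integral_bvpSol (hT : T ≠ 0) (hy : Continuous y) :
    ∫ s in (0 : ℝ)..η, bvpSol T η c₁ c₂ c₃ c₄ y s =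
      (∫ s in (0 : ℝ)..η, dirichletSol T y s)
        + (c₁ * dirichletSol T y η + c₂ * ∫ s in (0 : ℝ)..η, dirichletSol T y s)
          * (η - η ^ 2 / (2 * T))
        + (c₃ * dirichletSol T y η + c₄ * ∫ s in (0 : ℝ)..η, dirichletSol T y s)
          * (η ^ 2 / (2 * T)) := by
  have hw := continuous_dirichletSol (T := T) hy
  simp only [bvpSol]
  rw [integral_add (Continuous.intervalIntegrable (by fun_prop) _ _)
      (Continuous.intervalIntegrable (by fun_prop) _ _),
    integral_add (Continuous.intervalIntegrable (by fun_prop) _ _)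
      (Continuous.intervalIntegrable (by fun_prop) _ _),
    integral_const_mul, integral_const_mul, integral_div,
    integral_sub (Continuous.intervalIntegrable (by fun_prop) _ _)
      (Continuous.intervalIntegrable (by fun_prop) _ _), integral_div, integral_id, integral_const]
  simp only [smul_eq_mul]
  field_simp
  ring

theorem bvpSol_add {z : ℝ → ℝ} (hy : Continuous y) (hz : Continuous z) (t : ℝ) :
    bvpSol T η c₁ c₂ c₃ c₄ (fun s => y s + z s) t =
      bvpSol T η c₁ c₂ c₃ c₄ y t + bvpSol T η c₁ c₂ c₃ c₄ z t := by
  simp only [bvpSol, dirichletSol_add hy hz]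
  rw [integral_add ((continuous_dirichletSol hy).intervalIntegrable _ _)
    ((continuous_dirichletSol hz).intervalIntegrable _ _)]
  ring

theorem bvpSol_const_mul (a t : ℝ) : bvpSol T η c₁ c₂ c₃ c₄ (fun s => a * y s) t =
    a * bvpSol T η c₁ c₂ c₃ c₄ y t := by
  simp only [bvpSol, dirichletSol_const_mul, integral_const_mul]
  ring

/-- Both properties pass to sums with nonnegative coefficients. For the affine parts `1 - x` and
`x`, where `x = t / T`, the weight `x * (1 - x)` is below each of them and their values at `τ` are
at most `1`. -/
theorem bvpSol_nonneg_and_harnack (hη : 0 < η) (hηT : η < T) (hc₁ : 0 ≤ c₁) (hc₂ : 0 ≤ c₂)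
    (hc₃ : 0 ≤ c₃) (hc₄ : 0 ≤ c₄) (hy : Continuous y) (hy0 : ∀ s ∈ Icc 0 T, 0 ≤ y s) {t τ : ℝ}
    (ht : t ∈ Icc 0 T) (hτ : τ ∈ Icc 0 T) :
    0 ≤ bvpSol T η c₁ c₂ c₃ c₄ y t ∧
      t * (T - t) / T ^ 2 * bvpSol T η c₁ c₂ c₃ c₄ y τ ≤ bvpSol T η c₁ c₂ c₃ c₄ y t := by
  have hT : 0 < T := hη.trans hηT
  have hwη := dirichletSol_nonneg hT hy0 (t := η) ⟨hη.le, hηT.le⟩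
  have hW : 0 ≤ ∫ s in (0 : ℝ)..η, dirichletSol T y s := integral_nonneg hη.le fun s hs =>
    dirichletSol_nonneg hT hy0 ⟨hs.1, hs.2.trans hηT.le⟩
  have hp := add_nonneg (mul_nonneg hc₁ hwη) (mul_nonneg hc₂ hW)
  have hq := add_nonneg (mul_nonneg hc₃ hwη) (mul_nonneg hc₄ hW)
  have hx : ∀ x ∈ Icc 0 T, 0 ≤ x / T ∧ x / T ≤ 1 := fun x hx =>
    ⟨div_nonneg hx.1 hT.le, (div_le_one hT).2 hx.2⟩
  obtain ⟨ht0, ht1⟩ := hx t ht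
  obtain ⟨hτ0, hτ1⟩ := hx τ hτ
  have hk : t * (T - t) / T ^ 2 = t / T * (1 - t / T) := by field_simp
  have hH := dirichletSol_harnack hT hy hy0 ht hτ
  constructor
  · have := dirichletSol_nonneg hT hy0 ht
    exact add_nonneg (add_nonneg this (mul_nonneg hp (sub_nonneg.2 ht1))) (mul_nonneg hq ht0)
  · simp only [bvpSol]
    rw [mul_add, mul_add]
    refine add_le_add (add_le_add hH ?_) ?_
    · rw [mul_left_comm]
      refine mul_le_mul_of_nonneg_left ?_ hp
      rw [hk]
      nlinarith [mul_nonneg ht0 (sub_nonneg.2 ht1), mul_nonneg (sub_nonneg.2 ht1) hτ0]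
    · rw [mul_left_comm]
      refine mul_le_mul_of_nonneg_left ?_ hq
      rw [hk]
      nlinarith [mul_nonneg ht0 (sub_nonneg.2 ht1), mul_nonneg ht0 (sub_nonneg.2 hτ1)]

/-- Bounds, uniform in the right-hand side, for the solution and its derivative. -/
theorem exists_bvpSol_bounds (hη : 0 < η) (hηT : η < T) (c₁ c₂ c₃ c₄ : ℝ) :
    ∃ C : ℝ, 0 ≤ C ∧ ∀ y : ℝ → ℝ, Continuous y → ∀ M, (∀ s ∈ Icc 0 T, |y s| ≤ M) →
      ∀ t ∈ Icc 0 T, |bvpSol T η c₁ c₂ c₃ c₄ y t| ≤ C * M ∧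
        |deriv (bvpSol T η c₁ c₂ c₃ c₄ y) t| ≤ C * M := by
  have hT : 0 < T := hη.trans hηT
  let P : ℝ → ℝ → ℝ := fun a b => |a| * (2 * T ^ 2) + |b| * (2 * T ^ 2 * T)
  have hP0 : ∀ a b, 0 ≤ P a b := fun a b => by positivity
  refine ⟨2 * T ^ 2 + 2 * T + (P c₁ c₂ + P c₃ c₄) * (1 + 1 / T), by positivity, ?_⟩
  intro y hy M hM t ht
  have hM0 : 0 ≤ M := (abs_nonneg _).trans (hM 0 ⟨le_rfl, hT.le⟩)
  have hwη := abs_dirichletSol_le hT hM (t := η) ⟨hη.le, hηT.le⟩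
  have hW : |∫ s in (0 : ℝ)..η, dirichletSol T y s| ≤ 2 * T ^ 2 * T * M := by
    have h := norm_integral_le_of_norm_le_const (a := 0) (b := η) (f := dirichletSol T y)
      (C := 2 * T ^ 2 * M) fun s hs => by
        rw [uIoc_of_le hη.le] at hs
        exact abs_dirichletSol_le hT hM ⟨hs.1.le, hs.2.trans hηT.le⟩
    rw [Real.norm_eq_abs, sub_zero, abs_of_pos hη] at h
    calc _ ≤ 2 * T ^ 2 * M * η := h
      _ ≤ 2 * T ^ 2 * M * T := mul_le_mul_of_nonneg_left hηT.le (by positivity)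
      _ = 2 * T ^ 2 * T * M := by ring
  have hpq : ∀ a b : ℝ,
      |a * dirichletSol T y η + b * ∫ s in (0 : ℝ)..η, dirichletSol T y s| ≤ P a b * M := by
    intro a b
    calc _ ≤ _ := abs_add_le _ _
      _ ≤ |a| * (2 * T ^ 2 * M) + |b| * (2 * T ^ 2 * T * M) := by
          rw [abs_mul, abs_mul]
          exact add_le_add (mul_le_mul_of_nonneg_left hwη (abs_nonneg _))
            (mul_le_mul_of_nonneg_left hW (abs_nonneg _))
      _ = P a b * M := by simp only [P]; ring
  have hx0 : 0 ≤ t / T := div_nonneg ht.1 hT.le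
  have hx1 : t / T ≤ 1 := (div_le_one hT).2 ht.2
  have e1 : 0 ≤ P c₁ c₂ * M := mul_nonneg (hP0 _ _) hM0
  have e2 : 0 ≤ P c₃ c₄ * M := mul_nonneg (hP0 _ _) hM0
  have e3 : 0 ≤ T ^ 2 * M := by positivity
  have e4 : 0 ≤ T * M := by positivity
  have e5 : 0 ≤ (P c₁ c₂ * M + P c₃ c₄ * M) / T := div_nonneg (add_nonneg e1 e2) hT.le
  have hC : (2 * T ^ 2 + 2 * T + (P c₁ c₂ + P c₃ c₄) * (1 + 1 / T)) * M =
      2 * (T ^ 2 * M) + 2 * (T * M) + (P c₁ c₂ * M + P c₃ c₄ * M)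
        + (P c₁ c₂ * M + P c₃ c₄ * M) / T := by
    field_simp
    ring
  rw [hC]
  constructor
  · calc _ ≤ _ := abs_add_three _ _ _
      _ ≤ 2 * T ^ 2 * M + P c₁ c₂ * M + P c₃ c₄ * M := by
          refine add_le_add (add_le_add (abs_dirichletSol_le hT hM ht) ?_) ?_
          · rw [abs_mul, abs_of_nonneg (sub_nonneg.2 hx1)]
            exact (mul_le_of_le_one_right (abs_nonneg _) (by linarith)).trans (hpq _ _)
          · rw [abs_mul, abs_of_nonneg hx0]
            exact (mul_le_of_le_one_right (abs_nonneg _) hx1).trans (hpq _ _)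
      _ ≤ _ := by linarith
  · rw [deriv_bvpSol hy]
    calc _ ≤ _ := abs_add_le _ _
      _ ≤ 2 * T * M + (P c₁ c₂ * M + P c₃ c₄ * M) / T := by
          refine add_le_add (abs_dirichletDeriv_le hT hM ht) ?_
          rw [abs_div, abs_of_pos hT]
          refine div_le_div_of_nonneg_right ?_ hT.le
          exact (abs_sub _ _).trans (by linarith [hpq c₁ c₂, hpq c₃ c₄])
      _ ≤ _ := by linarith

end NonlocalProblem

/-! ### Compactness and the solution operator. -/

/-- A set of uniformly bounded, uniformly Lipschitz functions is compact. -/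
theorem isCompact_setOf_bounded_lipschitz {X : Type*} [PseudoMetricSpace X] [CompactSpace X]
    (M : ℝ) : IsCompact {v : C(X, ℝ) | (∀ x, |v x| ≤ M) ∧ ∀ x x', |v x - v x'| ≤ M * dist x x'} := by
  have hcont : ∀ g : X → ℝ, (∀ x x', |g x - g x'| ≤ M * dist x x') → UniformContinuous g := by
    intro g hg
    refine (LipschitzWith.of_dist_le_mul (K := M.toNNReal) fun x x' => ?_).uniformContinuous
    exact (hg x x').trans (mul_le_mul_of_nonneg_right (Real.le_coe_toNNReal M) dist_nonneg)
  refine ArzelaAscoli.isCompact_of_equicontinuous _ ?_ ?_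
  · have himage : ContinuousMap.toFun '' {v : C(X, ℝ) | (∀ x, |v x| ≤ M) ∧
        ∀ x x', |v x - v x'| ≤ M * dist x x'} =
        univ.pi (fun _ => Icc (-M) M) ∩ {g | ∀ x x', |g x - g x'| ≤ M * dist x x'} := by
      ext g
      constructor
      · rintro ⟨v, ⟨hv1, hv2⟩, rfl⟩
        exact ⟨fun x _ => abs_le.1 (hv1 x), hv2⟩
      · rintro ⟨hg1, hg2⟩
        exact ⟨⟨g, (hcont g hg2).continuous⟩, ⟨fun x => abs_le.2 (hg1 x trivial), hg2⟩, rfl⟩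
    rw [himage]
    refine (isCompact_univ_pi fun _ => isCompact_Icc).inter_right ?_
    simp only [ofPred_forall]
    exact isClosed_iInter fun x => isClosed_iInter fun x' =>
      isClosed_le (by fun_prop) continuous_const
  · refine UniformEquicontinuous.equicontinuous ?_
    refine Metric.uniformEquicontinuous_of_continuity_modulus (fun r => M * r) ?_ _ ?_
    · have : Tendsto (fun r : ℝ => M * r) (𝓝 0) (𝓝 (M * 0)) := (continuous_const_mul M).tendsto 0
      rwa [mul_zero] at this
    · rintro x x' ⟨v, hv⟩
      exact hv.2 x x'

/-- The solution operator of the linear nonlocal problem on `C([0, T])`: it is compact, positive,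
and satisfies a Harnack-type inequality. -/
theorem exists_solution_operator {T η α β : ℝ} (hη : 0 < η) (hηT : η < T) (hα : 0 < α)
    (hαT : α < 2 * T / η ^ 2) (hβ : 0 ≤ β)
    (hβT : β < (2 * T - α * η ^ 2) / (α * η ^ 2 - 2 * η + 2 * T)) (hT : 0 ≤ T) :
    ∃ L : C(Icc 0 T, ℝ) →L[ℝ] C(Icc 0 T, ℝ),
      (∀ M, ∃ S, IsCompact S ∧ MapsTo L (Metric.closedBall 0 M) S) ∧
      (∀ y, 0 ≤ y → 0 ≤ L y ∧ ∀ t τ : Icc 0 T, (t : ℝ) * (T - t) / T ^ 2 * L y τ ≤ L y t) ∧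
      ∀ y : C(Icc 0 T, ℝ), ∃ u : ℝ → ℝ, ContDiff ℝ 2 u ∧ (∀ t, deriv (deriv u) t = -IccExtend hT y t) ∧
        u 0 = β * u η ∧ (u T = α * ∫ s in (0 : ℝ)..η, u s) ∧ ∀ t : Icc 0 T, u t = L y t := by
  obtain ⟨c₁, c₂, c₃, c₄, hc₁, hc₂, hc₃, hc₄, hc⟩ :=
    exists_boundary_coefficients hη hηT hα hαT hβ hβT
  obtain ⟨C, hC0, hC⟩ := exists_bvpSol_bounds hη hηT c₁ c₂ c₃ c₄
  have hT0 : T ≠ 0 := (hη.trans hηT).ne'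
  -- Extending the source by constants gives a solution that is `C²` on all of `ℝ`, so `deriv` needs
  -- no care at the endpoints.
  let ext : C(Icc 0 T, ℝ) → ℝ → ℝ := fun y => IccExtend hT y
  have hext : ∀ y, Continuous (ext y) := fun y => y.continuous.Icc_extend'
  have hbound : ∀ (y : C(Icc 0 T, ℝ)), ∀ s ∈ Icc 0 T, |ext y s| ≤ ‖y‖ := fun y s _ =>
    y.norm_coe_le_norm (projIcc 0 T hT s)
  let U : C(Icc 0 T, ℝ) → ℝ → ℝ := fun y => bvpSol T η c₁ c₂ c₃ c₄ (ext y)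
  have hU : ∀ y, ContDiff ℝ 2 (U y) := fun y => contDiff_bvpSol hT0 (hext y)
  let Lₗ : C(Icc 0 T, ℝ) →ₗ[ℝ] C(Icc 0 T, ℝ) :=
    { toFun := fun y => ⟨fun t => U y t, (hU y).continuous.comp continuous_subtype_val⟩
      map_add' := fun y z => ContinuousMap.ext fun t => bvpSol_add (hext y) (hext z) t
      map_smul' := fun a y => ContinuousMap.ext fun t => bvpSol_const_mul a (t : ℝ) }
  let L := Lₗ.mkContinuous C fun y => by
    rw [ContinuousMap.norm_le _ (by positivity)]
    exact fun t => (hC _ (hext y) _ (hbound y) t t.2).1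
  have hLU : ∀ y t, L y t = U y t := fun y t => rfl
  refine ⟨L, fun M => ⟨_, isCompact_setOf_bounded_lipschitz (C * M), fun y hy => ⟨?_, ?_⟩⟩,
    fun y hy => ?_, fun y => ⟨U y, hU y, fun t => ?_, ?_, ?_, fun t => rfl⟩⟩
  · have hy' : ‖y‖ ≤ M := mem_closedBall_zero_iff.1 hy
    exact fun t => (hC _ (hext y) M (fun s hs => (hbound y s hs).trans hy') t t.2).1
  · have hy' : ‖y‖ ≤ M := mem_closedBall_zero_iff.1 hy
    intro x x'
    exact (convex_Icc 0 T).norm_image_sub_le_of_norm_deriv_le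
      (fun t _ => ((hU y).differentiable two_ne_zero) t)
      (fun t ht => (hC _ (hext y) M (fun s hs => (hbound y s hs).trans hy') t ht).2) x'.2 x.2
  · have hy0 : ∀ s ∈ Icc 0 T, 0 ≤ ext y s := fun s _ => hy (projIcc 0 T hT s)
    have h := fun t τ : Icc 0 T =>
      bvpSol_nonneg_and_harnack hη hηT hc₁ hc₂ hc₃ hc₄ (hext y) hy0 t.2 τ.2
    exact ⟨fun t => (h t t).1, fun t τ => (h t τ).2⟩
  · exact congrFun (deriv_deriv_bvpSol hT0 (hext y)) t
  · simp only [U]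
    rw [bvpSol_zero]
    exact (hc _ _).1
  · simp only [U]
    rw [bvpSol_right hT0, integral_bvpSol hT0 (hext y)]
    exact (hc _ _).2

end ThreePointBVP

namespace ThreePointBVP

/-! ### The nonlinear integral equation in the Harnack cone. -/

section Hammerstein

variable {X : Type*} [TopologicalSpace X] [CompactSpace X]

/-- The cone of nonnegative functions satisfying the Harnack-type inequality `k * ‖u‖ ≤ u`. -/
def harnackCone (k : C(X, ℝ)) (hk : 0 ≤ k) : ConvexCone ℝ C(X, ℝ) where
  carrier := {u | 0 ≤ u ∧ ∀ t, k t * ‖u‖ ≤ u t}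
  smul_mem' c hc u hu := by
    refine ⟨smul_nonneg hc.le hu.1, fun t => ?_⟩
    rw [norm_smul, Real.norm_of_nonneg hc.le, ContinuousMap.smul_apply, smul_eq_mul,
      mul_left_comm]
    exact mul_le_mul_of_nonneg_left (hu.2 t) hc.le
  add_mem' u hu v hv := by
    refine ⟨add_nonneg hu.1 hv.1, fun t => ?_⟩
    calc k t * ‖u + v‖ ≤ k t * (‖u‖ + ‖v‖) :=
          mul_le_mul_of_nonneg_left (norm_add_le u v) (hk t)
      _ ≤ u t + v t := by rw [mul_add]; exact add_le_add (hu.2 t) (hv.2 t)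

theorem mem_harnackCone {k : C(X, ℝ)} {hk : 0 ≤ k} {u : C(X, ℝ)} :
    u ∈ harnackCone k hk ↔ 0 ≤ u ∧ ∀ t, k t * ‖u‖ ≤ u t := Iff.rfl

theorem isClosed_harnackCone (k : C(X, ℝ)) (hk : 0 ≤ k) :
    IsClosed (harnackCone k hk : Set C(X, ℝ)) := by
  have h : (harnackCone k hk : Set C(X, ℝ)) =
      {u | ∀ t, 0 ≤ u t} ∩ {u | ∀ t, k t * ‖u‖ ≤ u t} := rfl
  rw [h]
  simp only [ofPred_forall]
  exact (isClosed_iInter fun t => isClosed_le continuous_const (by fun_prop)).inter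
    (isClosed_iInter fun t => isClosed_le (by fun_prop) (by fun_prop))

theorem norm_le_norm_add_of_nonneg {u v : C(X, ℝ)} (hu : 0 ≤ u) (hv : 0 ≤ v) :
    ‖u‖ ≤ ‖u + v‖ := by
  refine (ContinuousMap.norm_le _ (norm_nonneg _)).2 fun t => ?_
  refine le_trans ?_ ((u + v).norm_coe_le_norm t)
  have h1 : 0 ≤ u t := hu t
  have h2 : 0 ≤ v t := hv t
  rw [ContinuousMap.add_apply, Real.norm_of_nonneg h1, Real.norm_of_nonneg (add_nonneg h1 h2)]
  linarith

/-- A Hammerstein equation `u = L (a * f u)` with a compact positive linear operator satisfying a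
Harnack-type inequality has a nonzero solution in the associated cone if the nonlinearity is
superlinear or sublinear. -/
theorem exists_nonzero_solution_hammerstein [Nonempty X] {L : C(X, ℝ) →L[ℝ] C(X, ℝ)}
    {k a : C(X, ℝ)} (hk0 : 0 ≤ k) (hk1 : k ≤ 1)
    (hLc : ∀ M, ∃ S, IsCompact S ∧ MapsTo L (Metric.closedBall 0 M) S)
    (hL : ∀ y, 0 ≤ y → 0 ≤ L y ∧ ∀ t τ, k t * L y τ ≤ L y t)
    (ha : 0 ≤ a) (hak : L (a * k) ≠ 0) (f : C(ℝ, ℝ)) (hf : ∀ x, 0 ≤ f x)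
    (hcase : Superlinear f ∨ Sublinear f) :
    ∃ u ∈ harnackCone k hk0, u ≠ 0 ∧ L (a * f.comp u) = u := by
  let K := harnackCone k hk0
  let y : C(X, ℝ) → C(X, ℝ) := fun u => a * f.comp u
  have hy : Continuous y := continuous_const.mul f.continuous_postcomp
  have hy0 : ∀ u, 0 ≤ y u := fun u t => mul_nonneg (ha t) (hf (u t))
  let A : C(X, ℝ) → C(X, ℝ) := fun u => L (y u)
  have hA : Continuous A := L.continuous.comp hy
  have hAK : MapsTo A K K := by
    intro u _
    refine mem_harnackCone.2 ⟨(hL _ (hy0 u)).1, fun t => ?_⟩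
    have hAt : 0 ≤ A u t := (hL _ (hy0 u)).1 t
    rcases (show 0 ≤ k t from hk0 t).eq_or_lt with hkt | hkt
    · rw [← hkt, zero_mul]
      exact hAt
    · rw [← le_div_iff₀' hkt, ContinuousMap.norm_le _ (div_nonneg hAt hkt.le)]
      intro τ
      have hAτ : 0 ≤ A u τ := (hL _ (hy0 u)).1 τ
      rw [le_div_iff₀' hkt, Real.norm_of_nonneg hAτ]
      exact (hL _ (hy0 u)).2 t τ
  have hcomp : ∀ M, ∃ S, IsCompact S ∧ MapsTo A (K ∩ Metric.closedBall 0 M) S := by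
    intro M
    obtain ⟨b, hb⟩ := (isCompact_Icc (a := -M) (b := M)).exists_bound_of_continuousOn
      f.continuous.continuousOn
    obtain ⟨S, hS, hLS⟩ := hLc (‖a‖ * |b|)
    refine ⟨S, hS, fun u hu => hLS ?_⟩
    rw [mem_closedBall_zero_iff]
    refine (norm_mul_le _ _).trans (mul_le_mul_of_nonneg_left ?_ (norm_nonneg _))
    refine (ContinuousMap.norm_le _ (abs_nonneg b)).2 fun t => (hb (u t) ?_).trans (le_abs_self b)
    exact abs_le.1 ((u.norm_coe_le_norm t).trans (mem_closedBall_zero_iff.1 hu.2))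
  have hmem : ∀ u ∈ K, ∀ t, u t ∈ Icc 0 ‖u‖ := fun u hu t =>
    ⟨hu.1 t, (le_abs_self _).trans (u.norm_coe_le_norm t)⟩
  have hupper : ∀ u ∈ K, ∀ ε b : ℝ, 0 ≤ ε → 0 ≤ b → (∀ x ∈ Icc 0 ‖u‖, f x ≤ ε * x + b) →
      ‖A u‖ ≤ ‖L‖ * ‖a‖ * (ε * ‖u‖ + b) := by
    intro u hu ε b hε hb h
    rw [mul_assoc]
    refine (L.le_opNorm _).trans (mul_le_mul_of_nonneg_left ((norm_mul_le _ _).trans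
      (mul_le_mul_of_nonneg_left ?_ (norm_nonneg _))) (norm_nonneg _))
    refine (ContinuousMap.norm_le _ (by positivity)).2 fun t => ?_
    rw [ContinuousMap.comp_apply, Real.norm_of_nonneg (hf _)]
    have ht := hmem u hu t
    exact (h _ ht).trans (add_le_add_left (mul_le_mul_of_nonneg_left ht.2 hε) _)
  obtain ⟨t₁, hm⟩ : ∃ t₁, 0 < L (a * k) t₁ := by
    by_contra! hneg
    exact hak (ContinuousMap.ext fun t =>
      le_antisymm (hneg t) ((hL _ (mul_nonneg ha hk0)).1 t))
  have hlower : ∀ u ∈ K, ∀ M b : ℝ, 0 ≤ M → (∀ x ∈ Icc 0 ‖u‖, M * x - b ≤ f x) →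
      M * ‖u‖ * L (a * k) t₁ - b * L a t₁ ≤ ‖A u‖ := by
    intro u hu M b hM h
    -- In the cone `u ≥ k * ‖u‖`, so the linear lower bound on `f` passes to the source. Positivity
    -- of `L`, evaluated at `t₁`, turns it into a bound on `‖A u‖`.
    have hz : 0 ≤ y u - ((M * ‖u‖) • (a * k) - b • a) := by
      intro t
      have h1 := h _ (hmem u hu t)
      have h2 := mul_le_mul_of_nonneg_left (hu.2 t) hM
      have h3 : 0 ≤ a t * (f (u t) - M * (k t * ‖u‖) + b) :=
        mul_nonneg (ha t) (by linarith)
      change 0 ≤ a t * f (u t) - (M * ‖u‖ * (a t * k t) - b * a t)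
      linarith
    have h4 := (hL _ hz).1
    rw [map_sub, map_sub, map_smul, map_smul] at h4
    have h5 : 0 ≤ A u t₁ - (M * ‖u‖ * L (a * k) t₁ - b * L a t₁) := h4 t₁
    exact le_trans (by linarith) ((le_abs_self _).trans ((A u).norm_coe_le_norm t₁))
  have hmono : ∀ u ∈ K, ∀ v ∈ K, ‖u‖ ≤ ‖u + v‖ := fun u hu v hv =>
    norm_le_norm_add_of_nonneg hu.1 hv.1
  have h1K : (1 : C(X, ℝ)) ∈ K := ⟨zero_le_one, fun t => by simpa using hk1 t⟩
  have h0K : (0 : C(X, ℝ)) ∈ K := ⟨le_rfl, fun t => by simp⟩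
  obtain ⟨ε, hε, hNε⟩ : ∃ ε : ℝ, 0 < ε ∧ ‖L‖ * ‖a‖ * ε ≤ 1 / 2 := by
    have hN : 0 ≤ ‖L‖ * ‖a‖ := by positivity
    refine ⟨1 / (2 * (‖L‖ * ‖a‖ + 1)), by positivity, ?_⟩
    rw [mul_one_div, div_le_div_iff₀ (by positivity) two_pos]
    linarith
  -- The values `2` here and `1 / 2` above leave slack for strict inequalities near zero and for the
  -- additive constants at infinity.
  obtain ⟨M, hM, hMm⟩ : ∃ M : ℝ, 0 < M ∧ M * L (a * k) t₁ = 2 :=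
    ⟨2 / L (a * k) t₁, by positivity, div_mul_cancel₀ _ hm.ne'⟩
  have hMu : ∀ u : C(X, ℝ), M * ‖u‖ * L (a * k) t₁ = 2 * ‖u‖ := fun u => by
    rw [mul_right_comm, hMm]
  rcases hcase with ⟨h0, hinf⟩ | ⟨h0, hinf⟩
  · obtain ⟨r, hr, hfr⟩ := mem_nhdsGT_iff_exists_Ioo_subset.1 (h0.eventually_le_const hε)
    have hf0 : f 0 = 0 := by
      have h1 : Tendsto f (𝓝[>] 0) (𝓝 (f 0)) := f.continuous.continuousAt.mono_left
        nhdsWithin_le_nhds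
      have h2 : Tendsto (fun x => f x / x * x) (𝓝[>] 0) (𝓝 (0 * 0)) :=
        h0.mul (tendsto_id.mono_left nhdsWithin_le_nhds)
      rw [zero_mul] at h2
      refine tendsto_nhds_unique (h1.congr' ?_) h2
      filter_upwards [self_mem_nhdsWithin] with x hx
      exact (div_mul_cancel₀ _ (ne_of_gt hx)).symm
    obtain ⟨R, hR0, hfR⟩ :=
      ((hinf.eventually_ge_atTop M).and (eventually_gt_atTop 0)).exists_forall_of_atTop.imp
      fun R hR => (⟨(hR R le_rfl).2, fun x hx => (hR x hx).1⟩ : 0 < R ∧ ∀ x ≥ R, M ≤ f x / x)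
    refine exists_fixedPoint_of_cone_expansion (isClosed_harnackCone k hk0) hmono h1K norm_one h0K
      hA.continuousOn hAK hcomp hr (R := M * R * L a t₁) ?_ ?_
    · intro u hu hu0 hur
      have hu' := norm_pos_iff.2 hu0
      have h := hupper u hu ε 0 hε.le le_rfl fun x hx => by
        rcases hx.1.eq_or_lt with rfl | hx0
        · simp [hf0]
        · rw [add_zero, ← div_le_iff₀ hx0]
          exact hfr ⟨hx0, hx.2.trans_lt hur⟩
      nlinarith
    · intro u hu hRu
      -- Subtracting `M * R` makes the lower bound nonpositive for `x ≤ R`, so that it holds on the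
      -- whole half-line.
      have h := hlower u hu M (M * R) hM.le fun x hx => by
        rcases le_total x R with hxR | hxR
        · have := mul_le_mul_of_nonneg_left hxR hM.le
          linarith [hf x]
        · have h1 := (le_div_iff₀ (hR0.trans_le hxR)).1 (hfR x hxR)
          have : 0 ≤ M * R := by positivity
          linarith
      rw [hMu] at h
      linarith
  · obtain ⟨r, hr, hfr⟩ := mem_nhdsGT_iff_exists_Ioo_subset.1 (h0.eventually_ge_atTop M)
    obtain ⟨R, hR0, hfR⟩ :=
      ((hinf.eventually_le_const hε).and (eventually_gt_atTop 0)).exists_forall_of_atTop.imp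
      fun R hR => (⟨(hR R le_rfl).2, fun x hx => (hR x hx).1⟩ : 0 < R ∧ ∀ x ≥ R, f x / x ≤ ε)
    obtain ⟨b, hb⟩ := (isCompact_Icc (a := 0) (b := R)).exists_bound_of_continuousOn
      f.continuous.continuousOn
    have hb0 : 0 ≤ b := (norm_nonneg _).trans (hb 0 ⟨le_rfl, hR0.le⟩)
    refine exists_fixedPoint_of_cone_compression (isClosed_harnackCone k hk0) hmono h1K
      one_ne_zero h0K hA.continuousOn hAK hcomp hr (R := 2 * (‖L‖ * ‖a‖ * b)) ?_ ?_
    · intro u hu hu0 hur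
      have hu' := norm_pos_iff.2 hu0
      have h := hlower u hu M 0 hM.le fun x hx => by
        rw [sub_zero]
        rcases hx.1.eq_or_lt with rfl | hx0
        · simpa using hf 0
        · rw [← le_div_iff₀ hx0]
          exact hfr ⟨hx0, hx.2.trans_lt hur⟩
      rw [hMu] at h
      linarith
    · intro u hu hRu
      have h := hupper u hu ε b hε.le hb0 fun x hx => by
        rcases le_total x R with hxR | hxR
        · have h1 := (le_abs_self _).trans (hb x ⟨hx.1, hxR⟩)
          have := mul_nonneg hε.le hx.1
          linarith
        · have h1 := (div_le_iff₀ (hR0.trans_le hxR)).1 (hfR x hxR)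
          linarith
      have h2 := mul_le_mul_of_nonneg_right hNε (norm_nonneg u)
      linarith

end Hammerstein

end ThreePointBVP

/-! ### Application to the boundary value problem. -/

theorem theorem3p1 (T η α β : ℝ) (a f : ℝ → ℝ)
    (hη : 0 < η) (hηT : η < T)
    (hf : ContinuousOn f (Ici 0)) (hf_nonneg : ∀ x ∈ Ici (0 : ℝ), 0 ≤ f x)
    (ha : ContinuousOn a (Icc 0 T)) (ha_nonneg : ∀ t ∈ Icc 0 T, 0 ≤ a t)
    (ha_pos : ∃ t₀ ∈ Icc η T, 0 < a t₀)
    (hα : 0 < α) (hαT : α < 2 * T / η ^ 2)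
    (hβ : 0 ≤ β) (hβT : β < (2 * T - α * η ^ 2) / (α * η ^ 2 - 2 * η + 2 * T))
    (hcase : ThreePointBVP.Superlinear f ∨ ThreePointBVP.Sublinear f) :
    ∃ u : ℝ → ℝ, ThreePointBVP.IsPositiveSolution T η α β a f u := by
  open ThreePointBVP in
  have hT : 0 < T := hη.trans hηT
  have : Nonempty (Icc 0 T) := ⟨⟨0, le_rfl, hT.le⟩⟩
  obtain ⟨L, hLc, hL, hsol⟩ := exists_solution_operator hη hηT hα hαT hβ hβT hT.le
  let k : C(Icc 0 T, ℝ) := ⟨fun t => (t : ℝ) * (T - t) / T ^ 2, by fun_prop⟩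
  let a' : C(Icc 0 T, ℝ) := ⟨fun t => a t, ha.domRestrict⟩
  let f' : C(ℝ, ℝ) := ⟨fun x => f (max x 0),
    hf.comp_continuous (by fun_prop) fun x => le_max_right x 0⟩
  have hk0 : 0 ≤ k := fun t =>
    div_nonneg (mul_nonneg t.2.1 (sub_nonneg.2 t.2.2)) (by positivity)
  have hk1 : k ≤ 1 := fun t => by
    refine (div_le_one (by positivity)).2 ?_
    nlinarith [t.2.1, t.2.2]
  have hkpos : ∀ t : Icc 0 T, (t : ℝ) ∈ Ioo 0 T → 0 < k t := fun t ht =>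
    div_pos (mul_pos ht.1 (sub_pos.2 ht.2)) (by positivity)
  have hff' : ∀ x, 0 ≤ x → f' x = f x := fun x hx => congrArg f (max_eq_left hx)
  have hcase' : Superlinear f' ∨ Sublinear f' := by
    have h0 : (fun x => f x / x) =ᶠ[𝓝[>] 0] fun x => f' x / x :=
      eventually_mem_nhdsWithin.mono fun x hx => congrArg (· / x) (hff' x (le_of_lt hx)).symm
    have hinf : (fun x => f x / x) =ᶠ[atTop] fun x => f' x / x :=
      (eventually_ge_atTop 0).mono fun x hx => congrArg (· / x) (hff' x hx).symm
    exact hcase.imp (fun h => ⟨h.1.congr' h0, h.2.congr' hinf⟩)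
      fun h => ⟨h.1.congr' h0, h.2.congr' hinf⟩
  have hderiv : ∀ (y : C(Icc 0 T, ℝ)) (u : ℝ → ℝ),
      (∀ t, deriv (deriv u) t = -IccExtend hT.le y t) →
      ∀ t (ht : t ∈ Ioo 0 T), deriv (deriv u) t + y ⟨t, Ioo_subset_Icc_self ht⟩ = 0 := by
    intro y u h t ht
    rw [h, IccExtend_of_mem hT.le _ (Ioo_subset_Icc_self ht), neg_add_cancel]
  -- The equation recovers the source from the solution, so `L (a' * k) = 0` would give `a = 0` on
  -- `(0, T)`. Continuity carries this to the closure, which is needed because `t₀` may equal `T`,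
  -- where `k` vanishes.
  have hak : L (a' * k) ≠ 0 := by
    intro hzero
    obtain ⟨u, -, hu2, -, -, huL⟩ := hsol (a' * k)
    have hu0 : EqOn u (fun _ => 0) (Ioo 0 T) := fun t ht => by
      rw [huL ⟨t, Ioo_subset_Icc_self ht⟩, hzero]
      rfl
    have ha0 : EqOn a (fun _ => 0) (Ioo 0 T) := fun t ht => by
      have h1 := hderiv _ u hu2 t ht
      have h2 : deriv u =ᶠ[𝓝 t] deriv (fun _ => (0 : ℝ)) :=
        (hu0.eventuallyEq_of_mem (isOpen_Ioo.mem_nhds ht)).deriv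
      rw [h2.deriv_eq] at h1
      have h3 : (a' * k) ⟨t, Ioo_subset_Icc_self ht⟩ = 0 := by
        simpa only [deriv_const', deriv_const, zero_add] using h1
      exact (mul_eq_zero.1 h3).resolve_right (hkpos ⟨t, Ioo_subset_Icc_self ht⟩ ht).ne'
    obtain ⟨t₀, ht₀, hat₀⟩ := ha_pos
    have := ha0.of_subset_closure ha continuousOn_const Ioo_subset_Icc_self
      (closure_Ioo hT.ne).ge ⟨hη.le.trans ht₀.1, ht₀.2⟩
    exact hat₀.ne' this
  obtain ⟨v, hvK, hv0, hv⟩ := exists_nonzero_solution_hammerstein hk0 hk1 hLc hL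
    (show 0 ≤ a' from fun t => ha_nonneg t t.2) hak f' (fun x => hf_nonneg _ (le_max_right x 0)) hcase'
  obtain ⟨u, hu, hu2, hl, hr, huL⟩ := hsol (a' * f'.comp v)
  rw [hv] at huL
  refine ⟨u, hu.contDiffOn, fun t ht => ?_, hl, hr, fun t ht => ?_⟩
  · have h := hderiv _ u hu2 t ht
    have hvt : 0 ≤ v ⟨t, Ioo_subset_Icc_self ht⟩ := hvK.1 _
    rw [ContinuousMap.mul_apply, ContinuousMap.comp_apply, hff' _ hvt,
      ← huL ⟨t, Ioo_subset_Icc_self ht⟩] at h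
    exact h
  -- Membership in the cone gives `u t ≥ k t * ‖v‖`, which is positive in the interior.
  · rw [huL ⟨t, Ioo_subset_Icc_self ht⟩]
    exact (mul_pos (hkpos ⟨t, Ioo_subset_Icc_self ht⟩ ht) (norm_pos_iff.2 hv0)).trans_le (hvK.2 _)
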